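/- **Setting (bandits with concave rewards).** There are $m$ arms and $T$ rounds. In each round $t$ an arm $i_t$ is chosen (possibly at random) from the history of the previous rounds, and a vector $v_t\in[0,1]^d$ is observed which, given the past and $i_t=i$, has a fixed unknown law $D_i$ with mean $V_i$; let $V\in[0,1]^{d\times m}$ be the matrix with columns $V_i$, and $\Delta_m$ the simplex of distributions over arms. Let $f:[0,1]^d\to[0,1]$ be concave, $L$-Lipschitz on $[0,1]^d$ with respect to an $L_q$ norm $\|\cdot\|$ ($1\le q\le\infty$), differentiable, and $\mathcal C$-smooth: $f(z+\alpha(y-z))\ge f(z)+\alpha\nabla f(z)\cdot(y-z)-\frac{\mathcal C}{2}\alpha^2$ for all $y,z\in[0,1]^d$ and $\alpha\in[0,1]$. Let $\mathrm{OPT}_f$ be the supremum, over all (randomized, history-dependent) policies, of $\mathbb E\big[f(\frac1T\sum_{t=1}^T v_t)\big]$; the average regret is $\mathrm{avg\text{-}regret}_1(T)=\mathrm{OPT}_f-f(\frac1T\sum_{t=1}^T v_t)$. **Algorithm.** Fix $\gamma>0$. Before round $t$, let $k_{t,i}$ be the number of earlier plays of arm $i$, let $\hat V_{t,ji}=\frac{1}{k_{t,i}+1}\sum_{s<t:\,i_s=i}v_{s,j}$,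 let $\mathrm{rad}(\nu,N)=\sqrt{\gamma\nu/N}+\gamma/N$, and let $H_t$ be the set of all $d\times m$ matrices $W$ with $$\max\{0,\hat V_{t,ji}-2\,\mathrm{rad}(\hat V_{t,ji},k_{t,i}+1)\}\le W_{ji}\le\min\{1,\hat V_{t,ji}+2\,\mathrm{rad}(\hat V_{t,ji},k_{t,i}+1)\}\quad\text{for all } i,j.$$ In round $t$ the algorithm takes $(p_t,\tilde V_t)\in\arg\max_{p\in\Delta_m,\,W\in H_t}(Wp)\cdot\nabla f(\bar x_{t-1})$ (any measurable, history-dependent choice among the maximizers), sets $x_t=\tilde V_tp_t$, and plays arm $i$ with probability $p_{t,i}$. Here $\bar x_t=\frac1t\sum_{s=1}^t x_s$ for $t\ge1$, and $\bar x_0$ is an arbitrary point of $[0,1]^d$. **Theorem.** There are absolute constants $c_0,K>0$ such that for all $m,d,T\ge1$ with $mdT\ge2$, all such $D$, $\|\cdot\|$ and $f$, all $\delta\in(0,1)$ and all $\gamma\ge c_0\log\frac{mTd}{\delta}$, the following two bounds hold together with probability at least $1-\delta$: $$\mathrm{avg\text{-}regret}_1(T)\le K\Big(L\,\|\mathbf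 1_d\|\sqrt{\tfrac{\gamma m}{T}}+\tfrac{\mathcal C\log T}{T}\Big),$$ $$f(Vp)-f(\bar x_T)\le\frac{\mathcal C\log_2(2T)}{2T}\qquad\text{for every }p\in\Delta_m .$$ -/

import Mathlib

open MeasureTheory
open scoped Matrix unitInterval ENNReal

noncomputable section

namespace BwR

/-! ### Vectors, norms and smoothness -/

/-- The unit cube `[0,1]^d`. -/
def cube (d : ℕ) : Set (Fin d → ℝ) := Set.Icc 0 1

/-- The `L_q` norm of a vector of `ℝ^d`, for `1 ≤ q ≤ ∞`. -/
def lqNorm {d : ℕ} (q : ℝ≥0∞) (x : Fin d → ℝ) : ℝ :=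
  ‖(WithLp.toLp q x : PiLp q (fun _ : Fin d => ℝ))‖

/-- `f` is `L`-Lipschitz on the unit cube with respect to the `L_q` norm. -/
def IsLipschitz {d : ℕ} (q : ℝ≥0∞) (L : ℝ) (f : (Fin d → ℝ) → ℝ) : Prop :=
  ∀ x ∈ cube d, ∀ y ∈ cube d, f x - f y ≤ L * lqNorm q (x - y)

/-- The gradient at `z` of a function on the unit cube (one-sided where `z` is on the boundary). -/
def grad {d : ℕ} (f : (Fin d → ℝ) → ℝ) (z : Fin d → ℝ) : Fin d → ℝ :=
  fun j => fderivWithin ℝ f (cube d) z (Pi.single j 1)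

/-- `f` is differentiable on the unit cube and `C`-smooth there. -/
def IsSmooth {d : ℕ} (C : ℝ) (f : (Fin d → ℝ) → ℝ) : Prop :=
  DifferentiableOn ℝ f (cube d) ∧
    ∀ y ∈ cube d, ∀ z ∈ cube d, ∀ α ∈ Set.Icc (0 : ℝ) 1,
      f z + α * (grad f z ⬝ᵥ (y - z)) - C / 2 * α ^ 2 ≤ f (z + α • (y - z))

/-! ### The bandit model -/

/-- A history of `t` rounds: for each round, the arm that was played and the vector in `[0,1]^d`
that was observed. -/
abbrev Hist (m d t : ℕ) : Type := Fin t → Fin m × (Fin d → I)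

/-- A (randomized, history-dependent) policy: after a history `h` of `t` rounds, arm `i` is played
with probability `prob t h i`. -/
structure Policy (m d : ℕ) where
  prob : (t : ℕ) → Hist m d t → Fin m → ℝ
  prob_mem : ∀ t h, prob t h ∈ stdSimplex ℝ (Fin m)
  prob_measurable : ∀ t, Measurable (prob t)

/-- The law of the history of the first `t` rounds when policy `π` is used and playing arm `i`
yields an observation with law `D i`, independent of the past. -/
def histLaw {m d : ℕ} (D : Fin m → Measure (Fin d → I)) (π : Policy m d) :
    (t : ℕ) → Measure (Hist m d t)
  | 0 => Measure.dirac Fin.elim0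
  | t + 1 => (histLaw D π t).bind fun h =>
      ∑ i, ENNReal.ofReal (π.prob t h i) •
        (D i).map fun c => (Fin.snoc (α := fun _ => Fin m × (Fin d → I)) h (i, c) :
          Hist m d (t + 1))

/-- The matrix of mean observations: column `i` is the mean of the law of arm `i`. -/
def meanMatrix {m d : ℕ} (D : Fin m → Measure (Fin d → I)) : Matrix (Fin d) (Fin m) ℝ :=
  fun j i => ∫ c, (c j : ℝ) ∂(D i)

/-- The average of the observed vectors. -/
def avgObs {m d t : ℕ} (h : Hist m d t) : Fin d → ℝ :=
  fun j => (∑ s, ((h s).2 j : ℝ)) / t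

/-- The expected value of the optimal dynamic solution: the supremum, over all policies, of the
expected value of `f` at the average of the `T` observed vectors. -/
def opt {m d : ℕ} (D : Fin m → Measure (Fin d → I)) (f : (Fin d → ℝ) → ℝ) (T : ℕ) : ℝ :=
  ⨆ π : Policy m d, ∫ h, f (avgObs h) ∂(histLaw D π T)

/-- The average regret in the objective. -/
def avgRegret {m d T : ℕ} (D : Fin m → Measure (Fin d → I)) (f : (Fin d → ℝ) → ℝ)
    (h : Hist m d T) : ℝ :=
  opt D f T - f (avgObs h)

/-! ### Confidence bounds -/

/-- The confidence radius. -/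
def rad (γ ν N : ℝ) : ℝ := √(γ * ν / N) + γ / N

/-- The number of plays of arm `i` in a history. -/
def plays {m d t : ℕ} (h : Hist m d t) (i : Fin m) : ℕ :=
  (Finset.univ.filter fun s => (h s).1 = i).card

/-- The empirical average of component `j` of the observations of arm `i`. -/
def emp {m d t : ℕ} (h : Hist m d t) (j : Fin d) (i : Fin m) : ℝ :=
  (∑ s ∈ Finset.univ.filter fun s => (h s).1 = i, ((h s).2 j : ℝ)) / (plays h i + 1)

/-- Upper confidence bound. -/
def ucb {m d t : ℕ} (γ : ℝ) (h : Hist m d t) (j : Fin d) (i : Fin m) : ℝ :=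
  min 1 (emp h j i + 2 * rad γ (emp h j i) (plays h i + 1))

/-- Lower confidence bound. -/
def lcb {m d t : ℕ} (γ : ℝ) (h : Hist m d t) (j : Fin d) (i : Fin m) : ℝ :=
  max 0 (emp h j i - 2 * rad γ (emp h j i) (plays h i + 1))

/-- The set of all matrices that lie entrywise between the confidence bounds. -/
def confSet {m d t : ℕ} (γ : ℝ) (h : Hist m d t) : Set (Matrix (Fin d) (Fin m) ℝ) :=
  {W | ∀ j i, W j i ∈ Set.Icc (lcb γ h j i) (ucb γ h j i)}

/-! ### The primal algorithm -/

/-- A policy which, together with the distribution over arms, also chooses after each history an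
estimate of the matrix of means. -/
structure EstPolicy (m d : ℕ) extends Policy m d where
  est : (t : ℕ) → Hist m d t → Matrix (Fin d) (Fin m) ℝ
  est_measurable : ∀ t j i, Measurable fun h => est t h j i

/-- The running average `(1/t) ∑_{s=1}^t x_s` of the estimated mean observations `x_s`, each being
the chosen estimate applied to the chosen distribution in round `s`. The arbitrary initial point
`x₀` stands for the empty average. -/
def EstPolicy.avgEst {m d : ℕ} (A : EstPolicy m d) (x₀ : Fin d → ℝ) {t : ℕ} (h : Hist m d t) :
    Fin d → ℝ :=
  if t = 0 then x₀ else
    (t : ℝ)⁻¹ • ∑ s : Fin t,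
      A.est s (Fin.take s s.is_lt.le h) *ᵥ A.prob s (Fin.take s s.is_lt.le h)

/-- `A` is a run rule of the Frank-Wolfe based primal algorithm over `T` rounds: in each round the
pair (distribution `p`, estimate `W`) maximizes `(W p) ⬝ ∇f(running average)` over the simplex and
the confidence set. Ties may be broken in any way. -/
def EstPolicy.IsPrimal {m d : ℕ} (A : EstPolicy m d) (f : (Fin d → ℝ) → ℝ) (γ : ℝ)
    (x₀ : Fin d → ℝ) (T : ℕ) : Prop :=
  ∀ t < T, ∀ h : Hist m d t, A.est t h ∈ confSet γ h ∧
    ∀ p ∈ stdSimplex ℝ (Fin m), ∀ W ∈ confSet γ h,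
      (W *ᵥ p) ⬝ᵥ grad f (A.avgEst x₀ h) ≤ (A.est t h *ᵥ A.prob t h) ⬝ᵥ grad f (A.avgEst x₀ h)

end BwR

end

/-!
Call a history concentrated if the empirical means, the observations and the widths of the played
arms are all close to their (conditional) means. Freedman's and Azuma's inequalities, with a union
bound, show that this fails with probability at most `δ`; everything else is deterministic.

On a concentrated history the matrix `V` of means lies in every confidence set, so in each round the
chosen point `x_t` is at least as good as `V p` in the direction of the gradient at the running
average. Hence each round is a Frank–Wolfe step of size `1 / t`: with `g_t = f (V p) - f (x̄_t)`,
concavity and smoothness give `t g_t ≤ (t - 1) g_{t-1} + C / (2 t)`, and the harmonic sum bounds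
`T g_T`. This is the second bound.

For the first one, `opt ≤ max_p f (V p)` by Jensen's inequality, because the expected average
observation of any policy is `V p` for its expected average distribution `p`. It remains to compare
`x̄_T` with the average observation: they differ by a martingale and by the widths of the confidence
intervals of the played arms, whose sum is of order `√(γ m T)` since the `k`-th play of an arm costs
at most `8 √(γ / k)`.
-/

noncomputable section

namespace BwR

open ProbabilityTheory

theorem integrable_of_abs_le_one {Ω : Type*} [MeasurableSpace Ω] {μ : Measure Ω}
    [IsFiniteMeasure μ] {g : Ω → ℝ} (hg : Measurable g) (hb : ∀ ω, |g ω| ≤ 1) : Integrable g μ :=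
  Integrable.of_bound hg.aestronglyMeasurable 1 (ae_of_all _ hb)

/-! ### Random sequences with prescribed transition kernels -/

section RandomSequence

variable {X : Type*}

theorem take_snoc {s t : ℕ} (hs : s ≤ t) (hs' : s ≤ t + 1) (h : Fin t → X) (x : X) :
    Fin.take s hs' (Fin.snoc (α := fun _ => X) h x) = Fin.take s hs h := by
  funext r
  exact Fin.snoc_castSucc (α := fun _ => X) x h (Fin.castLE hs r)

variable [MeasurableSpace X]

theorem measurable_snoc (t : ℕ) :
    Measurable fun y : (Fin t → X) × X =>
      (Fin.snoc (α := fun _ => X) y.1 y.2 : Fin (t + 1) → X) := by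
  refine measurable_pi_iff.2 (Fin.lastCases ?_ fun s => ?_)
  · simpa only [Fin.snoc_last] using measurable_snd
  · simpa only [Fin.snoc_castSucc] using measurable_fst.eval

theorem measurable_take {s t : ℕ} (hs : s ≤ t) :
    Measurable (Fin.take s hs : (Fin t → X) → Fin s → X) :=
  measurable_pi_iff.2 fun _ => measurable_pi_apply _

/-- The law of the first `t` terms of a random sequence in `X` whose next term, given that the
terms so far are `h`, has law `κ t h`. -/
def seqLaw (κ : ∀ t, Kernel (Fin t → X) X) : ∀ t, Measure (Fin t → X)
  | 0 => Measure.dirac Fin.elim0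
  | t + 1 => (seqLaw κ t ⊗ₘ κ t).map fun y => Fin.snoc (α := fun _ => X) y.1 y.2

variable (κ : ∀ t, Kernel (Fin t → X) X) [∀ t, IsMarkovKernel (κ t)]

instance isProbabilityMeasure_seqLaw (t : ℕ) : IsProbabilityMeasure (seqLaw κ t) := by
  induction t with
  | zero => rw [seqLaw]; infer_instance
  | succ t ih => exact Measure.isProbabilityMeasure_map (measurable_snoc t).aemeasurable

theorem lintegral_seqLaw_succ (t : ℕ) {F : (Fin (t + 1) → X) → ℝ≥0∞} (hF : Measurable F) :
    ∫⁻ h, F h ∂(seqLaw κ (t + 1)) =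
      ∫⁻ h, ∫⁻ x, F (Fin.snoc (α := fun _ => X) h x) ∂(κ t h) ∂(seqLaw κ t) := by
  rw [seqLaw, lintegral_map hF (measurable_snoc t)]
  exact Measure.lintegral_compProd (hF.comp (measurable_snoc t))

theorem integral_seqLaw_succ (t : ℕ) {F : (Fin (t + 1) → X) → ℝ} (hF : Measurable F)
    (hi : Integrable F (seqLaw κ (t + 1))) :
    ∫ h, F h ∂(seqLaw κ (t + 1)) =
      ∫ h, ∫ x, F (Fin.snoc (α := fun _ => X) h x) ∂(κ t h) ∂(seqLaw κ t) := by
  rw [seqLaw, integral_map (measurable_snoc t).aemeasurable hF.aestronglyMeasurable]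
  exact Measure.integral_compProd ((integrable_map_measure hF.aestronglyMeasurable
    (measurable_snoc t).aemeasurable).1 hi)

theorem map_take_seqLaw {s t : ℕ} (hs : s ≤ t) :
    (seqLaw κ t).map (Fin.take s hs) = seqLaw κ s := by
  induction t, hs using Nat.le_induction with
  | base => exact Measure.map_id
  | succ t hs ih =>
    have hfst : (fun y : (Fin t → X) × X =>
        Fin.take s (hs.trans t.le_succ) (Fin.snoc (α := fun _ => X) y.1 y.2)) =
        Fin.take s hs ∘ Prod.fst := funext fun y => take_snoc hs _ y.1 y.2
    rw [seqLaw, Measure.map_map (measurable_take _) (measurable_snoc t), Function.comp_def, hfst,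
      ← Measure.map_map (measurable_take hs) measurable_fst, ← Measure.fst, Measure.fst_compProd,
      ih]

theorem seqLaw_preimage_take_le {s t : ℕ} (hs : s ≤ t) (B : Set (Fin s → X)) :
    seqLaw κ t (Fin.take s hs ⁻¹' B) ≤ seqLaw κ s B := by
  conv_rhs => rw [← map_take_seqLaw κ hs]
  exact Measure.le_map_apply (measurable_take hs).aemeasurable B

end RandomSequence

/-! ### Sums along a random sequence -/

section PathSum

variable {X : Type*} {G Y Z : ∀ t, (Fin t → X) → X → ℝ} {t : ℕ}

/-- The sum along a sequence of increments, each depending on the current term and on all the terms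
before it. -/
def pathSum (Y : ∀ t, (Fin t → X) → X → ℝ) {t : ℕ} (h : Fin t → X) : ℝ :=
  ∑ s : Fin t, Y s (Fin.take s s.is_lt.le h) (h s)

theorem pathSum_snoc (Y : ∀ t, (Fin t → X) → X → ℝ) {t : ℕ} (h : Fin t → X) (x : X) :
    pathSum Y (Fin.snoc (α := fun _ => X) h x : Fin (t + 1) → X) = pathSum Y h + Y t h x := by
  rw [pathSum, Fin.sum_univ_castSucc, Fin.snoc_last]
  congr 1
  · refine Finset.sum_congr rfl fun s _ => ?_
    rw [Fin.snoc_castSucc]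
    exact congrArg (fun g => Y s g (h s)) (take_snoc s.is_lt.le _ h x)
  · exact congrArg (fun g => Y t g x) (take_snoc le_rfl _ h x)

theorem abs_pathSum_le (hb : ∀ t h x, |Y t h x| ≤ 1) (h : Fin t → X) : |pathSum Y h| ≤ t :=
  calc |pathSum Y h| ≤ ∑ s : Fin t, |Y s (Fin.take s s.is_lt.le h) (h s)| :=
        Finset.abs_sum_le_sum_abs _ _
    _ ≤ ∑ _s : Fin t, (1 : ℝ) := Finset.sum_le_sum fun _ _ => hb _ _ _
    _ = t := by simp

variable [MeasurableSpace X]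

theorem measurable_pathSum (hY : ∀ t, Measurable (Y t).uncurry) (t : ℕ) :
    Measurable fun h : Fin t → X => pathSum Y h :=
  Finset.measurable_sum _ fun s _ =>
    (hY s).comp ((measurable_take s.is_lt.le).prodMk (measurable_pi_apply s))

variable (κ : ∀ t, Kernel (Fin t → X) X)

/-- The increments of the martingale part of `pathSum G`: each `G t h x` minus its conditional
mean given `h`. -/
def compensated (G : ∀ t, (Fin t → X) → X → ℝ) : ∀ t, (Fin t → X) → X → ℝ :=
  fun t h x => G t h x - ∫ y, G t h y ∂(κ t h)

theorem pathSum_compensated (G : ∀ t, (Fin t → X) → X → ℝ) {t : ℕ} (h : Fin t → X) :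
    pathSum (compensated κ G) h = pathSum G h -
      ∑ s : Fin t, ∫ x, G s (Fin.take s s.is_lt.le h) x ∂(κ s (Fin.take s s.is_lt.le h)) :=
  Finset.sum_sub_distrib _ _

variable [∀ t, IsMarkovKernel (κ t)]

theorem integral_pathSum_eq_zero (hY : ∀ t, Measurable (Y t).uncurry)
    (hb : ∀ t h x, |Y t h x| ≤ 1) (hc : ∀ t h, ∫ x, Y t h x ∂(κ t h) = 0) (t : ℕ) :
    ∫ h, pathSum Y h ∂(seqLaw κ t) = 0 := by
  induction t with
  | zero => simp [pathSum]
  | succ t ih =>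
    have hi : Integrable (fun h : Fin (t + 1) → X => pathSum Y h) (seqLaw κ (t + 1)) :=
      Integrable.of_bound (measurable_pathSum hY _).aestronglyMeasurable _
        (ae_of_all _ fun h => abs_pathSum_le hb h)
    rw [integral_seqLaw_succ κ t (measurable_pathSum hY _) hi, ← ih]
    refine integral_congr_ae (ae_of_all _ fun h => ?_)
    have hint : Integrable (Y t h) (κ t h) :=
      integrable_of_abs_le_one (hY t).of_uncurry_left (hb t h)
    simp only [pathSum_snoc]
    rw [integral_add (integrable_const _) hint, hc, integral_const, probReal_univ, one_smul,
      add_zero]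

theorem measurable_compensated (hG : ∀ t, Measurable (G t).uncurry) (t : ℕ) :
    Measurable (compensated κ G t).uncurry :=
  (hG t).sub ((hG t).stronglyMeasurable.integral_kernel_prod_right.measurable.comp measurable_fst)

theorem integrable_of_mem_Icc (hG : ∀ t, Measurable (G t).uncurry)
    (hmem : ∀ t h x, G t h x ∈ Set.Icc (0 : ℝ) 1) (t : ℕ) (h : Fin t → X) :
    Integrable (G t h) (κ t h) :=
  .of_mem_Icc 0 1 (hG t).of_uncurry_left.aemeasurable (ae_of_all _ (hmem t h))

theorem abs_compensated_le_one (hG : ∀ t, Measurable (G t).uncurry)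
    (hmem : ∀ t h x, G t h x ∈ Set.Icc (0 : ℝ) 1) (t : ℕ) (h : Fin t → X) (x : X) :
    |compensated κ G t h x| ≤ 1 := by
  have hint : ∫ y, G t h y ∂(κ t h) ∈ Set.Icc (0 : ℝ) 1 :=
    (convex_Icc 0 1).integral_mem isClosed_Icc (ae_of_all _ (hmem t h))
      (integrable_of_mem_Icc κ hG hmem t h)
  exact abs_sub_le_of_nonneg_of_le (hmem t h x).1 (hmem t h x).2 hint.1 hint.2

theorem integral_compensated (hG : ∀ t, Measurable (G t).uncurry)
    (hmem : ∀ t h x, G t h x ∈ Set.Icc (0 : ℝ) 1) (t : ℕ) (h : Fin t → X) :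
    ∫ x, compensated κ G t h x ∂(κ t h) = 0 := by
  simp only [compensated]
  rw [integral_sub (integrable_of_mem_Icc κ hG hmem t h) (integrable_const _), integral_const,
    probReal_univ, one_smul, sub_self]

theorem integral_pathSum_compensated (hG : ∀ t, Measurable (G t).uncurry)
    (hmem : ∀ t h x, G t h x ∈ Set.Icc (0 : ℝ) 1) (t : ℕ) :
    ∫ h, pathSum (compensated κ G) h ∂(seqLaw κ t) = 0 :=
  integral_pathSum_eq_zero κ (measurable_compensated κ hG) (abs_compensated_le_one κ hG hmem)
    (integral_compensated κ hG hmem) t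

theorem lintegral_exp_pathSum_le_one (hZ : ∀ t, Measurable (Z t).uncurry)
    (hexp : ∀ t h, ∫⁻ x, ENNReal.ofReal (Real.exp (Z t h x)) ∂(κ t h) ≤ 1) (t : ℕ) :
    ∫⁻ h, ENNReal.ofReal (Real.exp (pathSum Z h)) ∂(seqLaw κ t) ≤ 1 := by
  induction t with
  | zero => simp [pathSum]
  | succ t ih =>
    rw [lintegral_seqLaw_succ κ t (measurable_pathSum hZ _).exp.ennreal_ofReal]
    refine (lintegral_mono fun h => ?_).trans ih
    simp_rw [pathSum_snoc, Real.exp_add, ENNReal.ofReal_mul (Real.exp_pos _).le]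
    rw [lintegral_const_mul' _ _ ENNReal.ofReal_ne_top]
    exact mul_le_of_le_one_right' (hexp t h)

theorem measure_le_pathSum_le (hZ : ∀ t, Measurable (Z t).uncurry)
    (hexp : ∀ t h, ∫⁻ x, ENNReal.ofReal (Real.exp (Z t h x)) ∂(κ t h) ≤ 1) (t : ℕ) (η : ℝ) :
    seqLaw κ t {h | η ≤ pathSum Z h} ≤ ENNReal.ofReal (Real.exp (-η)) := by
  have hmarkov := (mul_meas_ge_le_lintegral (μ := seqLaw κ t)
    (measurable_pathSum hZ t).exp.ennreal_ofReal (ENNReal.ofReal (Real.exp η))).trans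
      (lintegral_exp_pathSum_le_one κ hZ hexp t)
  simp only [ENNReal.ofReal_le_ofReal_iff (Real.exp_pos _).le, Real.exp_le_exp] at hmarkov
  rw [Real.exp_neg, ENNReal.ofReal_inv_of_pos (Real.exp_pos η), ← one_div]
  exact (ENNReal.le_div_iff_mul_le (.inr one_ne_zero) (.inr ENNReal.one_ne_top)).2
    (mul_comm (ENNReal.ofReal _) _ ▸ hmarkov)

end PathSum

/-! ### Exponential inequalities -/

section Concentration

theorem integral_sq_le_one_of_abs_le_one {Ω : Type*} [MeasurableSpace Ω] {μ : Measure Ω}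
    [IsProbabilityMeasure μ] {g : Ω → ℝ} (hb : ∀ ω, |g ω| ≤ 1) : ∫ ω, g ω ^ 2 ∂μ ≤ 1 := by
  have := integral_mono_of_nonneg (μ := μ) (ae_of_all _ fun ω => sq_nonneg (g ω))
    (integrable_const (1 : ℝ)) (ae_of_all _ fun ω => (sq_le_one_iff_abs_le_one _).2 (hb ω))
  simpa using this

-- `exp x ≤ 1 + x + x²` for `|x| ≤ 1`, so `𝔼 exp (l g) ≤ 1 + l² v ≤ exp (l² v)`.
theorem lintegral_exp_mul_sub_le_one {Ω : Type*} [MeasurableSpace Ω] {μ : Measure Ω}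
    [IsProbabilityMeasure μ] {g : Ω → ℝ} {l v : ℝ} (hg : Measurable g) (hb : ∀ ω, |g ω| ≤ 1)
    (hmean : ∫ ω, g ω ∂μ = 0) (hvar : ∫ ω, g ω ^ 2 ∂μ ≤ v) (hl : |l| ≤ 1) :
    ∫⁻ ω, ENNReal.ofReal (Real.exp (l * g ω - l ^ 2 * v)) ∂μ ≤ 1 := by
  have hint : Integrable g μ := integrable_of_abs_le_one hg hb
  have hint_sq : Integrable (fun ω => g ω ^ 2) μ :=
    integrable_of_abs_le_one (hg.pow_const 2) fun ω => by
      rw [abs_pow]; exact pow_le_one₀ (abs_nonneg _) (hb ω)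
  have hexp : ∀ ω, Real.exp (l * g ω) ≤ 1 + l * g ω + l ^ 2 * g ω ^ 2 := fun ω => by
    have hlg : |l * g ω| ≤ 1 := abs_mul l _ ▸ mul_le_one₀ hl (abs_nonneg _) (hb ω)
    have := (abs_le.1 (Real.abs_exp_sub_one_sub_id_le hlg)).2
    linarith [mul_pow l (g ω) 2]
  have hint_lin : Integrable (fun ω => 1 + l * g ω) μ := (integrable_const 1).add (hint.const_mul l)
  have hint_quad : Integrable (fun ω => 1 + l * g ω + l ^ 2 * g ω ^ 2) μ :=
    hint_lin.add (hint_sq.const_mul _)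
  calc ∫⁻ ω, ENNReal.ofReal (Real.exp (l * g ω - l ^ 2 * v)) ∂μ
      ≤ ∫⁻ ω, ENNReal.ofReal
          ((1 + l * g ω + l ^ 2 * g ω ^ 2) * Real.exp (-(l ^ 2 * v))) ∂μ := by
        refine lintegral_mono fun ω => ENNReal.ofReal_le_ofReal ?_
        rw [sub_eq_add_neg, Real.exp_add]
        exact mul_le_mul_of_nonneg_right (hexp ω) (Real.exp_pos _).le
    _ = ENNReal.ofReal ((1 + l ^ 2 * ∫ ω, g ω ^ 2 ∂μ) * Real.exp (-(l ^ 2 * v))) := by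
        rw [← ofReal_integral_eq_lintegral_ofReal
          (hint_quad.mul_const _) (ae_of_all _ fun ω => mul_nonneg
            ((Real.exp_pos _).le.trans (hexp ω)) (Real.exp_pos _).le),
          integral_mul_const, integral_add hint_lin (hint_sq.const_mul _),
          integral_add (integrable_const 1) (hint.const_mul l), integral_const_mul,
          integral_const_mul, hmean]
        simp
    _ ≤ 1 := by
        rw [ENNReal.ofReal_le_one, Real.exp_neg, ← div_eq_mul_inv, div_le_one (Real.exp_pos _)]
        linarith [Real.add_one_le_exp (l ^ 2 * v), mul_le_mul_of_nonneg_left hvar (sq_nonneg l)]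

-- Optimizing `l S - l² a` over `l` suggests `l = √(η / a)`, which is admissible for `η ≤ a`.
theorem exists_le_mul_sub_sq_mul {η a : ℝ} (hη : 0 < η) (ha : η ≤ a) :
    ∃ l ∈ Set.Icc (0 : ℝ) 1, ∀ S, 2 * √(η * a) ≤ S → η ≤ l * S - l ^ 2 * a := by
  have ha0 : 0 < a := hη.trans_le ha
  refine ⟨√(η / a), ⟨Real.sqrt_nonneg _, Real.sqrt_le_one.2 ((div_le_one ha0).2 ha)⟩,
    fun S hS => ?_⟩
  have hmul : √(η / a) * √(η * a) = η := by
    rw [← Real.sqrt_mul (by positivity), show η / a * (η * a) = η ^ 2 by field_simp,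
      Real.sqrt_sq hη.le]
  have hsq : √(η / a) ^ 2 * a = η := by
    rw [Real.sq_sqrt (by positivity), div_mul_cancel₀ _ ha0.ne']
  linarith [mul_le_mul_of_nonneg_left hS (Real.sqrt_nonneg (η / a))]

theorem exists_le_mul_sub_sq_mul_of_add {η a : ℝ} (hη : 0 < η) :
    ∃ l ∈ Set.Icc (0 : ℝ) 1, ∀ S, 2 * √(η * a) + 2 * η ≤ S → η ≤ l * S - l ^ 2 * a := by
  rcases le_total η a with ha | ha
  · obtain ⟨l, hl, h⟩ := exists_le_mul_sub_sq_mul hη ha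
    exact ⟨l, hl, fun S hS => h S (by linarith)⟩
  · exact ⟨1, by simp, fun S hS => by linarith [Real.sqrt_nonneg (η * a)]⟩

variable {X : Type*} [MeasurableSpace X] {Y Q : ∀ t, (Fin t → X) → X → ℝ}
  (κ : ∀ t, Kernel (Fin t → X) X) [∀ t, IsMarkovKernel (κ t)]

theorem measure_le_mul_abs_pathSum_sub_le (hY : ∀ t, Measurable (Y t).uncurry)
    (hQ : ∀ t, Measurable (Q t).uncurry)
    (hexp : ∀ l : ℝ, |l| ≤ 1 → ∀ t h,
      ∫⁻ x, ENNReal.ofReal (Real.exp (l * Y t h x - l ^ 2 * Q t h x)) ∂(κ t h) ≤ 1)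
    {l : ℝ} (hl : l ∈ Set.Icc (0 : ℝ) 1) (t : ℕ) (η : ℝ) :
    seqLaw κ t {h | η ≤ l * |pathSum Y h| - l ^ 2 * pathSum Q h} ≤
      2 * ENNReal.ofReal (Real.exp (-η)) := by
  have hone_sided : ∀ k : ℝ, |k| ≤ 1 →
      seqLaw κ t {h | η ≤ k * pathSum Y h - k ^ 2 * pathSum Q h} ≤
        ENNReal.ofReal (Real.exp (-η)) := fun k hk => by
    have hsum : ∀ h : Fin t → X, k * pathSum Y h - k ^ 2 * pathSum Q h =
        pathSum (fun t h x => k * Y t h x - k ^ 2 * Q t h x) h := fun h => by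
      simp only [pathSum, Finset.mul_sum, Finset.sum_sub_distrib]
    simp only [hsum]
    exact measure_le_pathSum_le κ (Z := fun t h x => k * Y t h x - k ^ 2 * Q t h x)
      (fun t => by fun_prop) (hexp k hk) t η
  have habs : |l| ≤ 1 := abs_le.2 ⟨by linarith [hl.1], hl.2⟩
  refine (measure_mono (t := _ ∪ _) fun h (hh : η ≤ _) => ?_).trans ((measure_union_le _ _).trans
    ((add_le_add (hone_sided l habs) (hone_sided (-l) (by rwa [abs_neg]))).trans_eq
      (two_mul _).symm))
  rcases abs_cases (pathSum Y h) with ⟨habs, -⟩ | ⟨habs, -⟩ <;> rw [habs] at hh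
  · exact Or.inl hh
  · exact Or.inr (by simpa only [Set.mem_ofPred_eq, neg_sq, neg_mul, mul_neg] using hh)

/-- A form of Freedman's inequality, in which `pathSum Q` bounds the quadratic variation. -/
theorem measure_pathSum_le_and_lt_abs_pathSum_le (hY : ∀ t, Measurable (Y t).uncurry)
    (hQ : ∀ t, Measurable (Q t).uncurry)
    (hexp : ∀ l : ℝ, |l| ≤ 1 → ∀ t h,
      ∫⁻ x, ENNReal.ofReal (Real.exp (l * Y t h x - l ^ 2 * Q t h x)) ∂(κ t h) ≤ 1)
    (t : ℕ) (a : ℝ) {η : ℝ} (hη : 0 < η) :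
    seqLaw κ t {h | pathSum Q h ≤ a ∧ 2 * √(η * a) + 2 * η < |pathSum Y h|} ≤
      2 * ENNReal.ofReal (Real.exp (-η)) := by
  obtain ⟨l, hl, hle⟩ := exists_le_mul_sub_sq_mul_of_add (a := a) hη
  refine (measure_mono fun h hh => ?_).trans
    (measure_le_mul_abs_pathSum_sub_le κ hY hQ hexp hl t η)
  have := mul_le_mul_of_nonneg_left hh.1 (sq_nonneg l)
  exact (hle _ hh.2.le).trans (by linarith)

/-- A form of Azuma's inequality. -/
theorem measure_lt_abs_pathSum_le (hY : ∀ t, Measurable (Y t).uncurry)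
    (hb : ∀ t h x, |Y t h x| ≤ 1) (hc : ∀ t h, ∫ x, Y t h x ∂(κ t h) = 0)
    (t : ℕ) {η : ℝ} (hη : 0 < η) :
    seqLaw κ t {h | 2 * √(η * t) < |pathSum Y h|} ≤ 2 * ENNReal.ofReal (Real.exp (-η)) := by
  rcases lt_or_ge (t : ℝ) η with ht | ht
  · have hempty : {h : Fin t → X | 2 * √(η * t) < |pathSum Y h|} = ∅ :=
      Set.eq_empty_of_forall_notMem fun h hh => by
        have hsqrt : (t : ℝ) ≤ √(η * t) :=
          Real.le_sqrt_of_sq_le (by nlinarith [Nat.cast_nonneg (α := ℝ) t])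
        have hh' : 2 * √(η * t) < |pathSum Y h| := hh
        linarith [abs_pathSum_le hb h, Real.sqrt_nonneg (η * t)]
    rw [hempty, measure_empty]
    exact zero_le
  obtain ⟨l, hl, hle⟩ := exists_le_mul_sub_sq_mul hη ht
  have hexp : ∀ l : ℝ, |l| ≤ 1 → ∀ t h,
      ∫⁻ x, ENNReal.ofReal (Real.exp (l * Y t h x - l ^ 2 * 1)) ∂(κ t h) ≤ 1 := fun l hl t h =>
    lintegral_exp_mul_sub_le_one (hY t).of_uncurry_left (hb t h) (hc t h)
      (integral_sq_le_one_of_abs_le_one (hb t h)) hl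
  refine (measure_mono fun h hh => ?_).trans
    (measure_le_mul_abs_pathSum_sub_le κ hY (fun _ => measurable_const) hexp hl t η)
  have hcount : pathSum (fun _ _ _ => (1 : ℝ)) h = t := by simp [pathSum]
  simpa only [Set.mem_ofPred_eq, hcount] using hle _ (le_of_lt hh)

theorem measure_lt_abs_pathSum_compensated_le {G : ∀ t, (Fin t → X) → X → ℝ}
    (hG : ∀ t, Measurable (G t).uncurry) (hmem : ∀ t h x, G t h x ∈ Set.Icc (0 : ℝ) 1)
    (t : ℕ) {η : ℝ} (hη : 0 < η) :
    seqLaw κ t {h | 2 * √(η * t) < |pathSum (compensated κ G) h|} ≤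
      2 * ENNReal.ofReal (Real.exp (-η)) :=
  measure_lt_abs_pathSum_le κ (measurable_compensated κ hG) (abs_compensated_le_one κ hG hmem)
    (integral_compensated κ hG hmem) t hη

end Concentration

/-! ### The bandit as a random sequence -/

section Bandit

variable {m d : ℕ} (D : Fin m → Measure (Fin d → I)) (π : Policy m d)

theorem measurable_prob (t : ℕ) (i : Fin m) : Measurable fun h => π.prob t h i :=
  measurable_pi_iff.1 (π.prob_measurable t) i

theorem sum_ofReal_prob (t : ℕ) (h : Hist m d t) : ∑ i, ENNReal.ofReal (π.prob t h i) = 1 := by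
  rw [← ENNReal.ofReal_sum_of_nonneg fun i _ => (π.prob_mem t h).1 i, (π.prob_mem t h).2,
    ENNReal.ofReal_one]

/-- The law of the arm played and of the vector observed in a round, as a kernel from the past. -/
def roundKernel (t : ℕ) : Kernel (Hist m d t) (Fin m × (Fin d → I)) where
  toFun h := ∑ i, ENNReal.ofReal (π.prob t h i) • (D i).map (Prod.mk i)
  measurable' := by
    refine Measure.measurable_of_measurable_coe _ fun B _ => ?_
    simp only [Measure.coe_finsetSum, Finset.sum_apply, Measure.smul_apply, smul_eq_mul]
    exact Finset.measurable_sum _ fun i _ => (measurable_prob π t i).ennreal_ofReal.mul_const _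

theorem roundKernel_apply (t : ℕ) (h : Hist m d t) :
    roundKernel D π t h = ∑ i, ENNReal.ofReal (π.prob t h i) • (D i).map (Prod.mk i) := rfl

theorem lintegral_roundKernel (t : ℕ) (h : Hist m d t) {g : Fin m × (Fin d → I) → ℝ≥0∞}
    (hg : Measurable g) :
    ∫⁻ x, g x ∂(roundKernel D π t h) =
      ∑ i, ENNReal.ofReal (π.prob t h i) * ∫⁻ c, g (i, c) ∂(D i) := by
  rw [roundKernel_apply, lintegral_finsetSum_measure]
  refine Finset.sum_congr rfl fun i _ => ?_
  rw [lintegral_smul_measure, lintegral_map hg measurable_prodMk_left, smul_eq_mul]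

theorem integral_roundKernel (t : ℕ) (h : Hist m d t) {g : Fin m × (Fin d → I) → ℝ}
    (hg : Measurable g) (hint : ∀ i, Integrable (fun c => g (i, c)) (D i)) :
    ∫ x, g x ∂(roundKernel D π t h) = ∑ i, π.prob t h i * ∫ c, g (i, c) ∂(D i) := by
  rw [roundKernel_apply, integral_finsetSum_measure fun i _ =>
    ((integrable_map_measure hg.aestronglyMeasurable measurable_prodMk_left.aemeasurable).2
      (hint i)).smul_measure ENNReal.ofReal_ne_top]
  refine Finset.sum_congr rfl fun i _ => ?_
  rw [integral_smul_measure, integral_map measurable_prodMk_left.aemeasurable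
    hg.aestronglyMeasurable, ENNReal.toReal_ofReal ((π.prob_mem t h).1 i), smul_eq_mul]

variable [∀ i, IsProbabilityMeasure (D i)]

instance isMarkovKernel_roundKernel (t : ℕ) : IsMarkovKernel (roundKernel D π t) where
  isProbabilityMeasure h := ⟨by
    rw [← lintegral_one, lintegral_roundKernel D π t h measurable_const]
    simp [sum_ofReal_prob]⟩

theorem histLaw_eq_seqLaw (t : ℕ) : histLaw D π t = seqLaw (roundKernel D π) t := by
  induction t with
  | zero => rfl
  | succ t ih =>
    rw [histLaw, seqLaw, Measure.compProd_eq_comp_prod, Measure.map_comp _ _ (measurable_snoc t),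
      ih]
    congr 1
    funext h
    rw [Kernel.map_apply _ (measurable_snoc t), Kernel.prod_apply, Kernel.id_apply,
      Measure.dirac_prod, Measure.map_map (measurable_snoc t) measurable_prodMk_left,
      roundKernel_apply, Measure.map_finset_sum
        ((measurable_snoc t).comp measurable_prodMk_left).aemeasurable]
    refine Finset.sum_congr rfl fun i _ => ?_
    rw [Measure.map_smul, Measure.map_map ((measurable_snoc t).comp measurable_prodMk_left)
      measurable_prodMk_left]
    rfl

end Bandit

/-! ### Concentration of the empirical means -/

section EmpiricalMean

variable {m d : ℕ} (D : Fin m → Measure (Fin d → I))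

/-- The sum of component `j` of the observations of arm `i`. -/
def obsSum {t : ℕ} (h : Hist m d t) (j : Fin d) (i : Fin m) : ℝ :=
  ∑ s ∈ Finset.univ.filter fun s => (h s).1 = i, ((h s).2 j : ℝ)

/-- The deviation of component `j` of the observation from its mean, in the rounds in which arm `i`
is played. -/
def armDeviation (j : Fin d) (i : Fin m) : ∀ t, Hist m d t → Fin m × (Fin d → I) → ℝ :=
  fun _ _ x => if x.1 = i then (x.2 j : ℝ) - meanMatrix D j i else 0

/-- The mean of component `j` of the observation, in the rounds in which arm `i` is played. It
bounds the conditional variance of `armDeviation` given the arm. -/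
def armMean (j : Fin d) (i : Fin m) : ∀ t, Hist m d t → Fin m × (Fin d → I) → ℝ :=
  fun _ _ x => if x.1 = i then meanMatrix D j i else 0

theorem pathSum_armDeviation (j : Fin d) (i : Fin m) {t : ℕ} (h : Hist m d t) :
    pathSum (armDeviation D j i) h = obsSum h j i - plays h i * meanMatrix D j i := by
  simp [pathSum, armDeviation, obsSum, plays, ← Finset.sum_filter]

theorem pathSum_armMean (j : Fin d) (i : Fin m) {t : ℕ} (h : Hist m d t) :
    pathSum (armMean D j i) h = plays h i * meanMatrix D j i := by
  simp [pathSum, armMean, plays, ← Finset.sum_filter]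

theorem measurable_coord (j : Fin d) : Measurable fun c : Fin d → I => (c j : ℝ) :=
  measurable_subtype_coe.comp (measurable_pi_apply j)

theorem measurableSet_arm_eq (t : ℕ) (i : Fin m) :
    MeasurableSet {y : Hist m d t × Fin m × (Fin d → I) | y.2.1 = i} :=
  (measurable_fst.comp measurable_snd) (measurableSet_singleton i)

theorem measurable_armDeviation (j : Fin d) (i : Fin m) (t : ℕ) :
    Measurable (armDeviation D j i t).uncurry :=
  Measurable.ite (measurableSet_arm_eq t i)
    (((measurable_coord j).comp (measurable_snd.comp measurable_snd)).sub_const _) measurable_const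

theorem measurable_armMean (j : Fin d) (i : Fin m) (t : ℕ) :
    Measurable (armMean D j i t).uncurry :=
  Measurable.ite (measurableSet_arm_eq t i) measurable_const measurable_const

variable (π : Policy m d) [∀ i, IsProbabilityMeasure (D i)]

theorem integrable_coord (i : Fin m) (j : Fin d) :
    Integrable (fun c : Fin d → I => (c j : ℝ)) (D i) :=
  .of_mem_Icc 0 1 (measurable_coord j).aemeasurable (ae_of_all _ fun c => (c j).2)

theorem meanMatrix_mem_Icc (j : Fin d) (i : Fin m) : meanMatrix D j i ∈ Set.Icc (0 : ℝ) 1 :=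
  (convex_Icc 0 1).integral_mem isClosed_Icc (ae_of_all _ fun c => (c j).2)
    (integrable_coord D i j)

theorem integral_coord_sub_meanMatrix (j : Fin d) (i : Fin m) :
    ∫ c, ((c j : ℝ) - meanMatrix D j i) ∂(D i) = 0 := by
  rw [integral_sub (integrable_coord D i j) (integrable_const _), integral_const, probReal_univ,
    one_smul, meanMatrix, sub_self]

theorem integral_coord_sub_meanMatrix_sq_le (j : Fin d) (i : Fin m) :
    ∫ c, ((c j : ℝ) - meanMatrix D j i) ^ 2 ∂(D i) ≤ meanMatrix D j i := by
  have hvar := variance_le_sub_mul_sub (μ := D i) (ae_of_all _ fun c => (c j).2)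
    (measurable_coord j).aemeasurable
  rw [variance_eq_integral (measurable_coord j).aemeasurable] at hvar
  change ∫ c, ((c j : ℝ) - meanMatrix D j i) ^ 2 ∂(D i) ≤
    (1 - meanMatrix D j i) * (meanMatrix D j i - 0) at hvar
  nlinarith [sq_nonneg (meanMatrix D j i)]

theorem lintegral_exp_armDeviation_le_one (j : Fin d) (i : Fin m) {l : ℝ} (hl : |l| ≤ 1) (t : ℕ)
    (h : Hist m d t) :
    ∫⁻ x, ENNReal.ofReal (Real.exp (l * armDeviation D j i t h x - l ^ 2 * armMean D j i t h x))
      ∂(roundKernel D π t h) ≤ 1 := by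
  have hY := (measurable_armDeviation D j i t).of_uncurry_left (x := h)
  have hQ := (measurable_armMean D j i t).of_uncurry_left (x := h)
  rw [lintegral_roundKernel D π t h (by fun_prop), ← sum_ofReal_prob π t h]
  refine Finset.sum_le_sum fun i' _ => mul_le_of_le_one_right' ?_
  rcases eq_or_ne i' i with rfl | hi
  · simpa only [armDeviation, armMean, if_true] using lintegral_exp_mul_sub_le_one
      ((measurable_coord j).sub_const _)
      (fun c => abs_sub_le_of_nonneg_of_le (c j).2.1 (c j).2.2 (meanMatrix_mem_Icc D j i').1
        (meanMatrix_mem_Icc D j i').2)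
      (integral_coord_sub_meanMatrix D j i') (integral_coord_sub_meanMatrix_sq_le D j i') hl
  · simp [armDeviation, armMean, hi]

theorem measure_plays_mul_le_and_lt_abs_le (j : Fin d) (i : Fin m) (t : ℕ) (a : ℝ) {η : ℝ}
    (hη : 0 < η) :
    histLaw D π t {h | plays h i * meanMatrix D j i ≤ a ∧
      2 * √(η * a) + 2 * η < |obsSum h j i - plays h i * meanMatrix D j i|} ≤
      2 * ENNReal.ofReal (Real.exp (-η)) := by
  simpa only [histLaw_eq_seqLaw, pathSum_armDeviation, pathSum_armMean] using
    measure_pathSum_le_and_lt_abs_pathSum_le (roundKernel D π) (measurable_armDeviation D j i)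
      (measurable_armMean D j i) (fun _ => lintegral_exp_armDeviation_le_one D π j i) t a hη

end EmpiricalMean

/-! ### Norms and the unit cube -/

section Cube

variable {m d : ℕ} {q : ℝ≥0∞}

theorem lqNorm_mono (hq : 1 ≤ q) {x y : Fin d → ℝ} (hxy : ∀ j, |x j| ≤ |y j|) :
    lqNorm q x ≤ lqNorm q y := by
  have : Fact (1 ≤ q) := ⟨hq⟩
  rw [lqNorm, lqNorm]
  rcases eq_or_ne q ∞ with rfl | hq'
  · rw [PiLp.norm_eq_ciSup, PiLp.norm_eq_ciSup]
    exact ciSup_mono (Set.finite_range _).bddAbove hxy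
  · have hq0 : 0 < q.toReal := ENNReal.toReal_pos (zero_lt_one.trans_le hq).ne' hq'
    rw [PiLp.norm_eq_sum hq0, PiLp.norm_eq_sum hq0]
    gcongr with j
    exact hxy j

theorem lqNorm_le_mul_lqNorm_one (hq : 1 ≤ q) {x : Fin d → ℝ} {c : ℝ} (hc : 0 ≤ c)
    (hx : ∀ j, |x j| ≤ c) : lqNorm q x ≤ c * lqNorm q (1 : Fin d → ℝ) := by
  have : Fact (1 ≤ q) := ⟨hq⟩
  calc lqNorm q x ≤ lqNorm q (c • (1 : Fin d → ℝ)) :=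
        lqNorm_mono hq fun j => by simpa [abs_of_nonneg hc] using hx j
    _ = c * lqNorm q (1 : Fin d → ℝ) := by
        rw [lqNorm, lqNorm, WithLp.toLp_smul, norm_smul, Real.norm_of_nonneg hc]

theorem lqNorm_nonneg (hq : 1 ≤ q) (x : Fin d → ℝ) : 0 ≤ lqNorm q x :=
  have : Fact (1 ≤ q) := ⟨hq⟩
  norm_nonneg _

theorem one_le_lqNorm_one (hd : d ≠ 0) (hq : 1 ≤ q) : 1 ≤ lqNorm q (1 : Fin d → ℝ) := by
  have : Fact (1 ≤ q) := ⟨hq⟩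
  simpa [lqNorm] using
    PiLp.norm_apply_le (WithLp.toLp q (1 : Fin d → ℝ)) ⟨0, Nat.pos_of_ne_zero hd⟩

theorem mem_cube {x : Fin d → ℝ} : x ∈ cube d ↔ ∀ j, x j ∈ Set.Icc (0 : ℝ) 1 :=
  forall_and.symm

theorem zero_mem_cube : (0 : Fin d → ℝ) ∈ cube d := Set.left_mem_Icc.2 zero_le_one

theorem one_mem_cube : (1 : Fin d → ℝ) ∈ cube d := Set.right_mem_Icc.2 zero_le_one

theorem convex_cube (d : ℕ) : Convex ℝ (cube d) := convex_Icc 0 1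

theorem mulVec_mem_cube {W : Matrix (Fin d) (Fin m) ℝ} (hW : ∀ j i, W j i ∈ Set.Icc (0 : ℝ) 1)
    {p : Fin m → ℝ} (hp : p ∈ stdSimplex ℝ (Fin m)) : W *ᵥ p ∈ cube d :=
  mem_cube.2 fun j => by
    simpa only [Matrix.mulVec, dotProduct, smul_eq_mul, mul_comm (W j _)] using
      (convex_Icc (0 : ℝ) 1).sum_mem (fun i _ => hp.1 i) hp.2 fun i _ => hW j i

theorem avgObs_mem_cube {t : ℕ} (h : Hist m d t) : avgObs h ∈ cube d :=
  mem_cube.2 fun j => by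
    refine ⟨div_nonneg (Finset.sum_nonneg fun s _ => ((h s).2 j).2.1) t.cast_nonneg,
      div_le_one_of_le₀ ?_ t.cast_nonneg⟩
    calc ∑ s, ((h s).2 j : ℝ) ≤ ∑ _s : Fin t, (1 : ℝ) :=
          Finset.sum_le_sum fun s _ => ((h s).2 j).2.2
      _ = t := by simp

end Cube

/-! ### The Frank–Wolfe step -/

section FrankWolfe

theorem le_add_of_concaveOn_of_hasFDerivWithinAt {E : Type*} [NormedAddCommGroup E]
    [NormedSpace ℝ E] {s : Set E} {f : E → ℝ} {f' : E →L[ℝ] ℝ} {y z : E} (hf : ConcaveOn ℝ s f)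
    (hf' : HasFDerivWithinAt f f' s z) (hy : y ∈ s) (hz : z ∈ s) : f y ≤ f z + f' (y - z) := by
  have hmaps : Set.MapsTo (AffineMap.lineMap z y : ℝ → E) (Set.Icc 0 1) s :=
    fun a ha => hf.1.lineMap_mem hz hy ha
  have hderiv : HasDerivWithinAt (f ∘ (AffineMap.lineMap z y : ℝ → E)) (f' (y - z))
      (Set.Icc 0 1) 0 :=
    HasFDerivWithinAt.comp_hasDerivWithinAt (t := s) 0 (by simpa using hf')
      AffineMap.hasDerivWithinAt_lineMap hmaps
  have hconc : ConcaveOn ℝ (Set.Icc (0 : ℝ) 1) (f ∘ (AffineMap.lineMap z y : ℝ → E)) :=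
    (hf.comp_affineMap _).subset hmaps (convex_Icc 0 1)
  have hslope := hconc.slope_le_of_hasDerivWithinAt (x := 0) (y := 1) (by simp) (by simp)
    zero_lt_one hderiv
  simp only [slope_def_field, Function.comp_apply, AffineMap.lineMap_apply_one,
    AffineMap.lineMap_apply_zero, sub_zero, div_one] at hslope
  linarith

variable {d : ℕ} {f : (Fin d → ℝ) → ℝ} {C : ℝ}

theorem fderivWithin_cube_apply (f : (Fin d → ℝ) → ℝ) (z v : Fin d → ℝ) :
    fderivWithin ℝ f (cube d) z v = grad f z ⬝ᵥ v := by
  conv_lhs => rw [pi_eq_sum_univ' v]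
  simp only [map_sum, map_smul, smul_eq_mul, dotProduct, grad, mul_comm]

theorem le_add_grad_dotProduct (hf : ConcaveOn ℝ (cube d) f) (hd : DifferentiableOn ℝ f (cube d))
    {y z : Fin d → ℝ} (hy : y ∈ cube d) (hz : z ∈ cube d) :
    f y ≤ f z + grad f z ⬝ᵥ (y - z) := by
  rw [← fderivWithin_cube_apply]
  exact le_add_of_concaveOn_of_hasFDerivWithinAt hf (hd z hz).hasFDerivWithinAt hy hz

theorem IsSmooth.nonneg (hs : IsSmooth C f) : 0 ≤ C := by
  have := hs.2 0 zero_mem_cube 0 zero_mem_cube 1 (by simp)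
  simp only [sub_self, dotProduct_zero, smul_zero, add_zero] at this
  linarith

theorem frankWolfe_step (hf : ConcaveOn ℝ (cube d) f) (hs : IsSmooth C f) {x y z : Fin d → ℝ}
    (hx : x ∈ cube d) (hy : y ∈ cube d) (hz : z ∈ cube d)
    (hmax : y ⬝ᵥ grad f z ≤ x ⬝ᵥ grad f z) {α : ℝ} (hα : α ∈ Set.Icc (0 : ℝ) 1) :
    f y - f (z + α • (x - z)) ≤ (1 - α) * (f y - f z) + C / 2 * α ^ 2 := by
  have hgrad : f y - f z ≤ grad f z ⬝ᵥ (x - z) := by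
    have := le_add_grad_dotProduct hf hs.1 hy hz
    rw [dotProduct_sub, dotProduct_comm _ y] at this
    rw [dotProduct_sub, dotProduct_comm _ x]
    linarith
  linarith [hs.2 x hx z hz α hα, mul_le_mul_of_nonneg_left hgrad hα.1]

theorem harmonic_le_logb_two {t : ℕ} (ht : t ≠ 0) : (harmonic t : ℝ) ≤ Real.logb 2 (2 * t) := by
  have hlog : Real.log t ≤ Real.logb 2 t := by
    rw [Real.logb, le_div_iff₀ (Real.log_pos one_lt_two)]
    exact mul_le_of_le_one_right (Real.log_natCast_nonneg t)
      (Real.log_two_lt_d9.le.trans (by norm_num))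
  rw [Real.logb_mul two_ne_zero (by positivity), Real.logb_self_eq_one one_lt_two]
  linarith [harmonic_le_one_add_log t]

end FrankWolfe

/-! ### The primal algorithm -/

section Primal

variable {m d T : ℕ} {A : EstPolicy m d} {f : (Fin d → ℝ) → ℝ} {γ C : ℝ} {x₀ : Fin d → ℝ}

/-- The estimated mean observation chosen after a history. -/
def EstPolicy.point (A : EstPolicy m d) {t : ℕ} (h : Hist m d t) : Fin d → ℝ :=
  A.est t h *ᵥ A.prob t h

theorem EstPolicy.avgEst_succ (A : EstPolicy m d) (x₀ : Fin d → ℝ) {t : ℕ}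
    (h : Hist m d (t + 1)) :
    A.avgEst x₀ h = A.avgEst x₀ (Fin.take t t.le_succ h) + ((t + 1 : ℕ) : ℝ)⁻¹ •
      (A.point (Fin.take t t.le_succ h) - A.avgEst x₀ (Fin.take t t.le_succ h)) := by
  have hsum : ((t + 1 : ℕ) : ℝ) • A.avgEst x₀ h =
      (t : ℝ) • A.avgEst x₀ (Fin.take t t.le_succ h) + A.point (Fin.take t t.le_succ h) := by
    rw [avgEst, if_neg t.succ_ne_zero, smul_inv_smul₀ (by positivity), Fin.sum_univ_castSucc]
    refine congrArg₂ (· + ·) ?_ rfl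
    rcases eq_or_ne t 0 with rfl | ht
    · simp
    · rw [avgEst, if_neg ht, smul_inv_smul₀ (Nat.cast_ne_zero.2 ht)]
      rfl
  refine smul_right_injective _ (by positivity : ((t + 1 : ℕ) : ℝ) ≠ 0) ?_
  simp only [hsum, smul_add, smul_inv_smul₀ (by positivity : ((t + 1 : ℕ) : ℝ) ≠ 0)]
  push_cast
  module

theorem mem_Icc_of_mem_confSet {t : ℕ} {h : Hist m d t} {W : Matrix (Fin d) (Fin m) ℝ}
    (hW : W ∈ confSet γ h) (j : Fin d) (i : Fin m) : W j i ∈ Set.Icc (0 : ℝ) 1 :=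
  ⟨(le_max_left _ _).trans (hW j i).1, (hW j i).2.trans (min_le_left _ _)⟩

theorem inv_natCast_succ_mem_Icc (t : ℕ) : ((t + 1 : ℕ) : ℝ)⁻¹ ∈ Set.Icc (0 : ℝ) 1 :=
  ⟨by positivity, Nat.cast_inv_le_one _⟩

theorem EstPolicy.IsPrimal.point_mem_cube (hA : A.IsPrimal f γ x₀ T) {t : ℕ} (ht : t < T)
    (h : Hist m d t) : A.point h ∈ cube d :=
  mulVec_mem_cube (mem_Icc_of_mem_confSet (hA t ht h).1) (A.prob_mem t h)

theorem EstPolicy.IsPrimal.avgEst_mem_cube (hA : A.IsPrimal f γ x₀ T) (hx₀ : x₀ ∈ cube d) {t : ℕ}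
    (ht : t ≤ T) (h : Hist m d t) : A.avgEst x₀ h ∈ cube d := by
  induction t with
  | zero => rwa [avgEst, if_pos rfl]
  | succ t ih =>
    rw [A.avgEst_succ]
    exact (convex_cube d).add_smul_sub_mem (ih (t.le_succ.trans ht) _) (hA.point_mem_cube ht _)
      (inv_natCast_succ_mem_Icc t)

theorem EstPolicy.IsPrimal.mul_sub_le_harmonic (hA : A.IsPrimal f γ x₀ T) (hx₀ : x₀ ∈ cube d)
    (hf : ConcaveOn ℝ (cube d) f) (hs : IsSmooth C f) {M : Matrix (Fin d) (Fin m) ℝ}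
    (hM : ∀ j i, M j i ∈ Set.Icc (0 : ℝ) 1) {p : Fin m → ℝ} (hp : p ∈ stdSimplex ℝ (Fin m)) {t : ℕ}
    (ht : t ≤ T) (h : Hist m d t)
    (hconf : ∀ s (hs : s < t), M ∈ confSet γ (Fin.take s hs.le h)) :
    t * (f (M *ᵥ p) - f (A.avgEst x₀ h)) ≤ C / 2 * harmonic t := by
  induction t with
  | zero => simp
  | succ t ih =>
    set h' := Fin.take t t.le_succ h
    have hprev := ih (t.le_succ.trans ht) h' fun s hs => hconf s (hs.trans t.lt_succ_self)
    have hstep := frankWolfe_step hf hs (hA.point_mem_cube ht h') (mulVec_mem_cube hM hp)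
      (hA.avgEst_mem_cube hx₀ (t.le_succ.trans ht) h')
      ((hA t ht h').2 p hp M (hconf t t.lt_succ_self)) (inv_natCast_succ_mem_Icc t)
    rw [← A.avgEst_succ] at hstep
    have hpos : (0 : ℝ) < (t + 1 : ℕ) := by positivity
    calc ((t + 1 : ℕ) : ℝ) * (f (M *ᵥ p) - f (A.avgEst x₀ h))
        ≤ (t + 1 : ℕ) * ((1 - ((t + 1 : ℕ) : ℝ)⁻¹) * (f (M *ᵥ p) - f (A.avgEst x₀ h')) +
            C / 2 * ((t + 1 : ℕ) : ℝ)⁻¹ ^ 2) := mul_le_mul_of_nonneg_left hstep hpos.le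
      _ = t * (f (M *ᵥ p) - f (A.avgEst x₀ h')) + C / 2 * ((t + 1 : ℕ) : ℝ)⁻¹ := by
          field_simp
          push_cast
          ring
      _ ≤ C / 2 * harmonic t + C / 2 * ((t + 1 : ℕ) : ℝ)⁻¹ := by gcongr
      _ = C / 2 * harmonic (t + 1) := by rw [harmonic_succ]; push_cast; ring

theorem EstPolicy.IsPrimal.sub_le_logb (hA : A.IsPrimal f γ x₀ T) (hx₀ : x₀ ∈ cube d)
    (hf : ConcaveOn ℝ (cube d) f) (hs : IsSmooth C f) {M : Matrix (Fin d) (Fin m) ℝ}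
    (hM : ∀ j i, M j i ∈ Set.Icc (0 : ℝ) 1) {p : Fin m → ℝ} (hp : p ∈ stdSimplex ℝ (Fin m))
    (hT : T ≠ 0) (h : Hist m d T)
    (hconf : ∀ s (hs : s < T), M ∈ confSet γ (Fin.take s hs.le h)) :
    f (M *ᵥ p) - f (A.avgEst x₀ h) ≤ C * Real.logb 2 (2 * T) / (2 * T) := by
  rw [le_div_iff₀ (by positivity)]
  linarith [hA.mul_sub_le_harmonic hx₀ hf hs hM hp le_rfl h hconf,
    mul_le_mul_of_nonneg_left (harmonic_le_logb_two hT) hs.nonneg]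

end Primal

/-! ### Confidence bounds -/

section Confidence

variable {m d t : ℕ} {γ : ℝ}

theorem emp_eq (h : Hist m d t) (j : Fin d) (i : Fin m) :
    emp h j i = obsSum h j i / (plays h i + 1) := rfl

theorem obsSum_nonneg (h : Hist m d t) (j : Fin d) (i : Fin m) : 0 ≤ obsSum h j i :=
  Finset.sum_nonneg fun s _ => ((h s).2 j).2.1

theorem obsSum_le_plays (h : Hist m d t) (j : Fin d) (i : Fin m) : obsSum h j i ≤ plays h i := by
  simpa [obsSum, plays] using Finset.sum_le_sum fun s (_ : s ∈ Finset.univ.filter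
    fun s => (h s).1 = i) => ((h s).2 j).2.2

theorem emp_mem_Icc (h : Hist m d t) (j : Fin d) (i : Fin m) :
    emp h j i ∈ Set.Icc (0 : ℝ) 1 :=
  ⟨div_nonneg (obsSum_nonneg h j i) (by positivity),
    div_le_one_of_le₀ ((obsSum_le_plays h j i).trans (lt_add_one _).le) (by positivity)⟩

theorem rad_div {S N : ℝ} (hN : 0 < N) : rad γ (S / N) N = (√(γ * S) + γ) / N := by
  rw [rad, add_div, ← mul_div_assoc, div_div, ← sq, Real.sqrt_div' _ (sq_nonneg N),
    Real.sqrt_sq hN.le]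

-- Solving the quadratic inequality `a ≤ S + 2√(ηa) + 2η` for `√a` gives `√a ≤ √S + 3√η`.
theorem abs_sub_le_of_abs_sub_le {a S η : ℝ} (ha : 0 ≤ a) (hS : 0 ≤ S) (hη : 0 ≤ η)
    (hdev : |S - a| ≤ 2 * √(η * a) + 2 * η) : |S - a| ≤ 2 * √(η * S) + 8 * η := by
  have hsqrt : √a ≤ √S + 3 * √η := by
    rw [Real.sqrt_mul hη] at hdev
    have hsq : (√a - √η) ^ 2 ≤ (√S + 2 * √η) ^ 2 := by
      nlinarith [Real.sq_sqrt ha, Real.sq_sqrt hη, Real.sq_sqrt hS, (abs_le.1 hdev).1,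
        mul_nonneg (Real.sqrt_nonneg η) (Real.sqrt_nonneg S)]
    linarith [(abs_le_of_sq_le_sq' hsq (by positivity)).2]
  calc |S - a| ≤ 2 * (√η * √a) + 2 * η := by rwa [← Real.sqrt_mul hη]
    _ ≤ 2 * (√η * (√S + 3 * √η)) + 2 * η := by gcongr
    _ = 2 * √(η * S) + 8 * η := by
        rw [Real.sqrt_mul hη]
        linear_combination 6 * Real.mul_self_sqrt hη

theorem mem_confSet_of_abs_sub_le {M : Matrix (Fin d) (Fin m) ℝ}
    (hM : ∀ j i, M j i ∈ Set.Icc (0 : ℝ) 1) (hγ : 1 ≤ γ) (h : Hist m d t)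
    (hdev : ∀ j i, |obsSum h j i - plays h i * M j i| ≤
      2 * √(γ / 8 * (plays h i * M j i)) + 2 * (γ / 8)) : M ∈ confSet γ h := by
  intro j i
  have hN : (0 : ℝ) < plays h i + 1 := by positivity
  have hS := obsSum_nonneg h j i
  have hroot : √(γ / 8 * obsSum h j i) ≤ √(γ * obsSum h j i) :=
    Real.sqrt_le_sqrt (mul_le_mul_of_nonneg_right (by linarith) hS)
  have habs := abs_le.1 (abs_sub_le_of_abs_sub_le
    (mul_nonneg (plays h i).cast_nonneg (hM j i).1) hS (by positivity) (hdev j i))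
  rw [lcb, ucb, emp_eq, rad_div hN]
  refine ⟨max_le (hM j i).1 ?_, le_min (hM j i).2 ?_⟩
  · rw [← mul_div_assoc, ← sub_div, div_le_iff₀ hN]
    linarith [(hM j i).1]
  · rw [← mul_div_assoc, ← add_div, le_div_iff₀ hN]
    linarith [(hM j i).2]

/-- An upper bound on the widths of the confidence intervals of an arm. It does not depend on the
component. -/
def width (γ : ℝ) (h : Hist m d t) (i : Fin m) : ℝ := min 1 (8 * √(γ / (plays h i + 1)))

theorem width_mem_Icc (γ : ℝ) (h : Hist m d t) (i : Fin m) : width γ h i ∈ Set.Icc (0 : ℝ) 1 :=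
  ⟨le_min zero_le_one (by positivity), min_le_left _ _⟩

theorem rad_le_two_mul_sqrt {ν N : ℝ} (hγ : 0 ≤ γ) (hν : ν ≤ 1) (hN : 0 < N)
    (hle : √(γ / N) ≤ 1) : rad γ ν N ≤ 2 * √(γ / N) := by
  have hsq : γ / N ≤ √(γ / N) := by
    nlinarith [Real.sq_sqrt (div_nonneg hγ hN.le), Real.sqrt_nonneg (γ / N)]
  have hroot : √(γ * ν / N) ≤ √(γ / N) := by
    gcongr
    exact mul_le_of_le_one_right hγ hν
  rw [rad]
  linarith

theorem ucb_sub_lcb_le_width (hγ : 0 ≤ γ) (h : Hist m d t) (j : Fin d) (i : Fin m) :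
    ucb γ h j i - lcb γ h j i ≤ width γ h i := by
  have hle_one : ucb γ h j i - lcb γ h j i ≤ 1 - 0 :=
    sub_le_sub (min_le_left _ _) (le_max_left _ _)
  have hle_rad := sub_le_sub (min_le_right 1 (emp h j i + 2 * rad γ (emp h j i) (plays h i + 1)))
    (le_max_right 0 (emp h j i - 2 * rad γ (emp h j i) (plays h i + 1)))
  rw [← ucb, ← lcb] at hle_rad
  rw [sub_zero] at hle_one
  refine le_min hle_one ?_
  rcases le_total √(γ / (plays h i + 1)) 1 with hr | hr
  · linarith [rad_le_two_mul_sqrt hγ (emp_mem_Icc h j i).2 (by positivity) hr]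
  · linarith

theorem abs_sub_le_width {W W' : Matrix (Fin d) (Fin m) ℝ} (hγ : 0 ≤ γ) {h : Hist m d t}
    (hW : W ∈ confSet γ h) (hW' : W' ∈ confSet γ h) (j : Fin d) (i : Fin m) :
    |W j i - W' j i| ≤ width γ h i :=
  (abs_sub_le_of_le_of_le (hW j i).1 (hW j i).2 (hW' j i).1 (hW' j i).2).trans
    (ucb_sub_lcb_le_width hγ h j i)

theorem abs_mulVec_sub_mulVec_le {W W' : Matrix (Fin d) (Fin m) ℝ} (hγ : 0 ≤ γ) {h : Hist m d t}
    (hW : W ∈ confSet γ h) (hW' : W' ∈ confSet γ h) {p : Fin m → ℝ} (hp : ∀ i, 0 ≤ p i)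
    (j : Fin d) : |(W *ᵥ p) j - (W' *ᵥ p) j| ≤ ∑ i, p i * width γ h i := by
  calc |(W *ᵥ p) j - (W' *ᵥ p) j| = |∑ i, p i * (W j i - W' j i)| := by
        simp only [Matrix.mulVec, dotProduct, mul_comm (p _), sub_mul, Finset.sum_sub_distrib]
    _ ≤ ∑ i, |p i * (W j i - W' j i)| := Finset.abs_sum_le_sum_abs _ _
    _ ≤ ∑ i, p i * width γ h i := Finset.sum_le_sum fun i _ => by
        rw [abs_mul, abs_of_nonneg (hp i)]
        exact mul_le_mul_of_nonneg_left (abs_sub_le_width hγ hW hW' j i) (hp i)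

end Confidence

/-! ### The sum of the widths of the played arms -/

section Width

variable {m d t : ℕ} {γ : ℝ}

theorem plays_eq_sum (h : Hist m d t) (i : Fin m) :
    plays h i = ∑ s, if (h s).1 = i then 1 else 0 :=
  Finset.card_filter _ _

theorem plays_snoc (h : Hist m d t) (x : Fin m × (Fin d → I)) (i : Fin m) :
    plays (Fin.snoc (α := fun _ => Fin m × (Fin d → I)) h x : Hist m d (t + 1)) i =
      plays h i + if x.1 = i then 1 else 0 := by
  rw [plays_eq_sum, plays_eq_sum, Fin.sum_univ_castSucc]
  simp

theorem sum_plays (h : Hist m d t) : ∑ i, plays h i = t := by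
  simp_rw [plays_eq_sum]
  rw [Finset.sum_comm]
  simp

theorem plays_le (h : Hist m d t) (i : Fin m) : plays h i ≤ t :=
  (Finset.single_le_sum (fun _ _ => Nat.zero_le _) (Finset.mem_univ i)).trans_eq (sum_plays h)

theorem measurable_plays (i : Fin m) : Measurable fun h : Hist m d t => plays h i := by
  simp_rw [plays_eq_sum]
  exact Finset.measurable_sum _ fun s _ => Measurable.ite
    ((measurable_fst.comp (measurable_pi_apply s)) (measurableSet_singleton i))
    measurable_const measurable_const

theorem measurable_width (γ : ℝ) (i : Fin m) : Measurable fun h : Hist m d t => width γ h i := by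
  have hcount : Measurable fun n : ℕ => min 1 (8 * √(γ / ((n : ℝ) + 1))) :=
    measurable_of_countable _
  exact hcount.comp (measurable_plays i)

/-- The width of the arm played in a round, as a function of the past and of that round. -/
def playedWidth (γ : ℝ) : ∀ t, Hist m d t → Fin m × (Fin d → I) → ℝ := fun _ h x => width γ h x.1

theorem measurable_playedWidth (γ : ℝ) (t : ℕ) :
    Measurable (playedWidth γ t : Hist m d t → Fin m × (Fin d → I) → ℝ).uncurry := by
  have hwidth : Measurable fun y : Hist m d t × Fin m => width γ y.1 y.2 :=
    measurable_from_prod_countable_left fun i => measurable_width γ i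
  have harm : Measurable fun y : Hist m d t × Fin m × (Fin d → I) => (y.1, y.2.1) :=
    measurable_fst.prodMk (measurable_fst.comp measurable_snd)
  have hcomp := hwidth.comp harm
  exact hcomp

theorem playedWidth_mem_Icc (γ : ℝ) (t : ℕ) (h : Hist m d t) (x : Fin m × (Fin d → I)) :
    playedWidth γ t h x ∈ Set.Icc (0 : ℝ) 1 :=
  width_mem_Icc γ h x.1

theorem integral_playedWidth (D : Fin m → Measure (Fin d → I)) [∀ i, IsProbabilityMeasure (D i)]
    (π : Policy m d) (γ : ℝ) (t : ℕ) (h : Hist m d t) :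
    ∫ x, playedWidth γ t h x ∂(roundKernel D π t h) = ∑ i, π.prob t h i * width γ h i := by
  rw [integral_roundKernel D π t h (measurable_playedWidth γ t).of_uncurry_left
    fun i => integrable_const (width γ h i)]
  simp [playedWidth]

theorem sqrt_div_add_one_le (hγ : 0 ≤ γ) (k : ℕ) :
    √(γ / (k + 1)) ≤ 2 * (√(γ * (k + 1)) - √(γ * k)) := by
  have hk : (0 : ℝ) < k + 1 := by positivity
  have hone : 1 ≤ 2 * (√(k + 1 : ℝ) - √k) * √(k + 1 : ℝ) := by
    nlinarith [sq_nonneg (√(k + 1 : ℝ) - √k), Real.sq_sqrt hk.le,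
      Real.sq_sqrt (k.cast_nonneg (α := ℝ))]
  rw [Real.sqrt_div hγ, Real.sqrt_mul hγ, Real.sqrt_mul hγ, div_le_iff₀ (Real.sqrt_pos.2 hk)]
  nlinarith [mul_le_mul_of_nonneg_left hone (Real.sqrt_nonneg γ)]

-- The `k`-th play of an arm costs at most `8√(γ/k)`, which telescopes into `16√(γk)`.
theorem pathSum_playedWidth_le_sum_sqrt (hγ : 0 ≤ γ) (h : Hist m d t) :
    pathSum (playedWidth γ) h ≤ 16 * ∑ i, √(γ * plays h i) := by
  induction t with
  | zero => simpa [pathSum] using Finset.sum_nonneg fun i _ => Real.sqrt_nonneg (γ * plays h i)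
  | succ t ih =>
    rw [← Fin.snoc_init_self h]
    set h' : Hist m d t := Fin.init h
    set x := h (Fin.last t)
    have hincr : ∑ i, √(γ * plays (Fin.snoc (α := fun _ => Fin m × (Fin d → I)) h' x :
        Hist m d (t + 1)) i) - ∑ i, √(γ * plays h' i) =
          √(γ * (plays h' x.1 + 1)) - √(γ * plays h' x.1) := by
      rw [← Finset.sum_sub_distrib, Finset.sum_eq_single x.1]
      · simp [plays_snoc]
      · intro i _ hi
        simp [plays_snoc, hi.symm]
      · simp
    have hwidth : width γ h' x.1 ≤ 8 * √(γ / (plays h' x.1 + 1)) := min_le_right _ _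
    rw [pathSum_snoc, playedWidth]
    linarith [ih h', sqrt_div_add_one_le hγ (plays h' x.1)]

theorem pathSum_playedWidth_le (hγ : 0 ≤ γ) (h : Hist m d t) :
    pathSum (playedWidth γ) h ≤ 16 * √(γ * m * t) := by
  have hcard : (∑ i, √(γ * plays h i)) ^ 2 ≤ γ * m * t :=
    calc (∑ i, √(γ * plays h i)) ^ 2 ≤ m * ∑ i, √(γ * plays h i) ^ 2 := by
          simpa using sq_sum_le_card_mul_sum_sq (s := Finset.univ) (f := fun i => √(γ * plays h i))
      _ = m * ∑ i, γ * plays h i := by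
          congr! 2 with i
          exact Real.sq_sqrt (by positivity)
      _ = γ * m * t := by
          rw [← Finset.mul_sum, ← Nat.cast_sum, sum_plays]
          ring
  exact (pathSum_playedWidth_le_sum_sqrt hγ h).trans (by gcongr; exact Real.le_sqrt_of_sq_le hcard)

end Width

/-! ### The optimal value -/

section Opt

variable {m d t : ℕ} (D : Fin m → Measure (Fin d → I)) (π : Policy m d)

/-- The average of the distributions over arms used along a history. -/
def Policy.avgProb (π : Policy m d) {t : ℕ} (h : Hist m d t) : Fin m → ℝ :=
  (t : ℝ)⁻¹ • ∑ s : Fin t, π.prob s (Fin.take s s.is_lt.le h)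

theorem Policy.avgProb_mem (ht : t ≠ 0) (h : Hist m d t) : π.avgProb h ∈ stdSimplex ℝ (Fin m) := by
  rw [avgProb, Finset.smul_sum]
  exact (convex_stdSimplex ℝ (Fin m)).sum_mem (fun _ _ => by positivity) (by simp [ht])
    fun s _ => π.prob_mem _ _

theorem Policy.measurable_avgProb (t : ℕ) : Measurable (π.avgProb : Hist m d t → Fin m → ℝ) :=
  have hsum : Measurable fun h : Hist m d t => ∑ s : Fin t, π.prob s (Fin.take s s.is_lt.le h) :=
    Finset.measurable_sum _ fun s _ => (π.prob_measurable s).comp (measurable_take s.is_lt.le)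
  hsum.const_smul (t : ℝ)⁻¹

theorem Policy.integrable_avgProb (ht : t ≠ 0) (μ : Measure (Hist m d t)) [IsFiniteMeasure μ] :
    Integrable (π.avgProb : Hist m d t → Fin m → ℝ) μ :=
  .of_eval fun i => .of_mem_Icc 0 1 (measurable_pi_iff.1 (π.measurable_avgProb t) i).aemeasurable
    (ae_of_all _ fun h => mem_Icc_of_mem_stdSimplex (π.avgProb_mem ht h) i)

/-- Component `j` of the observation of a round, as a function of the past and of that round. -/
def obsCoord (j : Fin d) : ∀ t, Hist m d t → Fin m × (Fin d → I) → ℝ := fun _ _ x => x.2 j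

theorem measurable_obsCoord (j : Fin d) (t : ℕ) :
    Measurable (obsCoord j t : Hist m d t → Fin m × (Fin d → I) → ℝ).uncurry :=
  (measurable_coord j).comp (measurable_snd.comp measurable_snd)

theorem obsCoord_mem_Icc (j : Fin d) (t : ℕ) (h : Hist m d t) (x : Fin m × (Fin d → I)) :
    obsCoord j t h x ∈ Set.Icc (0 : ℝ) 1 :=
  (x.2 j).2

theorem measurable_avgObs (t : ℕ) : Measurable (avgObs : Hist m d t → Fin d → ℝ) :=
  measurable_pi_iff.2 fun j => (measurable_pathSum (measurable_obsCoord j) t).div_const _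

theorem integrable_avgObs (μ : Measure (Hist m d t)) [IsFiniteMeasure μ] :
    Integrable (avgObs : Hist m d t → Fin d → ℝ) μ :=
  .of_eval fun j => .of_mem_Icc 0 1 (measurable_pi_iff.1 (measurable_avgObs t) j).aemeasurable
    (ae_of_all _ fun h => mem_cube.1 (avgObs_mem_cube h) j)

variable [∀ i, IsProbabilityMeasure (D i)]

instance isProbabilityMeasure_histLaw (t : ℕ) : IsProbabilityMeasure (histLaw D π t) :=
  histLaw_eq_seqLaw D π t ▸ inferInstance

theorem compensated_obsCoord (j : Fin d) (t : ℕ) (h : Hist m d t) (x : Fin m × (Fin d → I)) :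
    compensated (roundKernel D π) (obsCoord j) t h x =
      x.2 j - (meanMatrix D *ᵥ π.prob t h) j := by
  rw [compensated, integral_roundKernel D π t h (measurable_obsCoord j t).of_uncurry_left
    fun i => integrable_coord D i j]
  simp only [obsCoord, Matrix.mulVec, dotProduct, meanMatrix, mul_comm]

theorem avgObs_sub_mulVec_avgProb (h : Hist m d t) (j : Fin d) :
    avgObs h j - (meanMatrix D *ᵥ π.avgProb h) j =
      pathSum (compensated (roundKernel D π) (obsCoord j)) h / t := by
  simp only [pathSum, compensated_obsCoord, avgObs, Policy.avgProb, Matrix.mulVec_smul,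
    Matrix.mulVec_sum, Pi.smul_apply, Finset.sum_apply, Finset.sum_sub_distrib, smul_eq_mul]
  ring

theorem integral_avgObs (ht : t ≠ 0) :
    ∫ h, avgObs h ∂(histLaw D π t) = meanMatrix D *ᵥ ∫ h, π.avgProb h ∂(histLaw D π t) := by
  let V := (Matrix.mulVecLin (meanMatrix D)).toContinuousLinearMap
  have hprob := π.integrable_avgProb ht (histLaw D π t)
  have hnoise : ∀ j, ∫ h, (avgObs h j - V (π.avgProb h) j) ∂(histLaw D π t) = 0 := fun j => by
    calc ∫ h, (avgObs h j - V (π.avgProb h) j) ∂(histLaw D π t)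
        = ∫ h, pathSum (compensated (roundKernel D π) (obsCoord j)) h / t ∂(histLaw D π t) :=
          integral_congr_ae (ae_of_all _ fun h => avgObs_sub_mulVec_avgProb D π h j)
      _ = 0 := by
          rw [integral_div, histLaw_eq_seqLaw, integral_pathSum_compensated _
            (measurable_obsCoord j) (obsCoord_mem_Icc j), zero_div]
  change _ = V (∫ h, π.avgProb h ∂(histLaw D π t))
  rw [← V.integral_comp_comm hprob, ← sub_eq_zero,
    ← integral_sub (integrable_avgObs _) (V.integrable_comp hprob)]
  funext j
  exact (eval_integral ((integrable_avgObs _).sub (V.integrable_comp hprob)).eval j).trans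
    (hnoise j)

theorem integrable_comp_avgObs {f : (Fin d → ℝ) → ℝ} (hf : ContinuousOn f (cube d))
    (μ : Measure (Hist m d t)) [IsFiniteMeasure μ] : Integrable (fun h => f (avgObs h)) μ := by
  obtain ⟨b, hb⟩ := isCompact_Icc.exists_bound_of_continuousOn hf
  have hmeas : Measurable fun h : Hist m d t => f (avgObs h) :=
    hf.domRestrict.measurable.comp ((measurable_avgObs t).subtype_mk (h := avgObs_mem_cube))
  exact .of_bound hmeas.aestronglyMeasurable b (ae_of_all _ fun h => hb _ (avgObs_mem_cube h))

theorem opt_le [Nonempty (Policy m d)] {f : (Fin d → ℝ) → ℝ} (hf : ConcaveOn ℝ (cube d) f)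
    (hcont : ContinuousOn f (cube d)) (ht : t ≠ 0) {b : ℝ}
    (hle : ∀ p ∈ stdSimplex ℝ (Fin m), f (meanMatrix D *ᵥ p) ≤ b) : opt D f t ≤ b := by
  refine ciSup_le fun π => ?_
  have hmean : ∫ h, π.avgProb h ∂(histLaw D π t) ∈ stdSimplex ℝ (Fin m) :=
    (convex_stdSimplex ℝ (Fin m)).integral_mem (isClosed_stdSimplex ..)
      (ae_of_all _ (π.avgProb_mem ht)) (π.integrable_avgProb ht _)
  calc ∫ h, f (avgObs h) ∂(histLaw D π t) ≤ f (∫ h, avgObs h ∂(histLaw D π t)) :=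
        hf.le_map_integral hcont isClosed_Icc (ae_of_all _ avgObs_mem_cube)
          (integrable_avgObs _) (integrable_comp_avgObs hcont _)
    _ = f (meanMatrix D *ᵥ ∫ h, π.avgProb h ∂(histLaw D π t)) := by rw [integral_avgObs D π ht]
    _ ≤ b := hle _ hmean

end Opt

/-! ### Concentration along a run -/

section Concentrated

theorem measure_iUnion_le_card_mul {Ω ι : Type*} [MeasurableSpace Ω] [Fintype ι] {μ : Measure Ω}
    {B : ι → Set Ω} {ε : ℝ≥0∞} (hB : ∀ k, μ (B k) ≤ ε) : μ (⋃ k, B k) ≤ Fintype.card ι * ε := by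
  simpa using (measure_iUnion_fintype_le μ B).trans (Finset.sum_le_sum fun k _ => hB k)

variable {m d T : ℕ} (D : Fin m → Measure (Fin d → I)) (π : Policy m d)

/-- The favourable event of the analysis, at confidence level `η`: the empirical means of all arms
before every round, the observations, and the widths of the played arms are all concentrated around
their (conditional) means. -/
structure IsConcentrated (γ η : ℝ) (h : Hist m d T) : Prop where
  abs_obsSum_sub_le : ∀ s (hs : s < T) j i,
    |obsSum (Fin.take s hs.le h) j i - plays (Fin.take s hs.le h) i * meanMatrix D j i| ≤
      2 * √(η * (plays (Fin.take s hs.le h) i * meanMatrix D j i)) + 2 * η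
  abs_pathSum_obsCoord_le : ∀ j,
    |pathSum (compensated (roundKernel D π) (obsCoord j)) h| ≤ 2 * √(η * T)
  abs_pathSum_playedWidth_le :
    |pathSum (compensated (roundKernel D π) (playedWidth γ)) h| ≤ 2 * √(η * T)

variable [∀ i, IsProbabilityMeasure (D i)]

-- A union bound over the round, the number of plays in it, the component and the arm.
theorem measure_exists_lt_abs_obsSum_sub_le (T : ℕ) {η : ℝ} (hη : 0 < η) :
    histLaw D π T {h | ∃ s, ∃ hs : s < T, ∃ j i,
      2 * √(η * (plays (Fin.take s hs.le h) i * meanMatrix D j i)) + 2 * η <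
        |obsSum (Fin.take s hs.le h) j i - plays (Fin.take s hs.le h) i * meanMatrix D j i|} ≤
      (T * (T * (d * m)) : ℕ) * (2 * ENNReal.ofReal (Real.exp (-η))) := by
  let B : Fin T × Fin T × Fin d × Fin m → Set (Hist m d T) := fun ⟨s, n, j, i⟩ =>
    Fin.take s s.is_lt.le ⁻¹' {h | plays h i * meanMatrix D j i ≤ n * meanMatrix D j i ∧
      2 * √(η * (n * meanMatrix D j i)) + 2 * η < |obsSum h j i - plays h i * meanMatrix D j i|}
  have hB : ∀ k, histLaw D π T (B k) ≤ 2 * ENNReal.ofReal (Real.exp (-η)) := fun ⟨s, n, j, i⟩ => by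
    rw [histLaw_eq_seqLaw]
    refine (seqLaw_preimage_take_le _ s.is_lt.le _).trans ?_
    rw [← histLaw_eq_seqLaw]
    exact measure_plays_mul_le_and_lt_abs_le D π j i s _ hη
  have hcard := measure_iUnion_le_card_mul hB
  simp only [Fintype.card_prod, Fintype.card_fin] at hcard
  refine (measure_mono ?_).trans hcard
  rintro h ⟨s, hs, j, i, hlt⟩
  exact Set.mem_iUnion.2
    ⟨(⟨s, hs⟩, ⟨plays (Fin.take s hs.le h) i, (plays_le _ i).trans_lt hs⟩, j, i), le_rfl, hlt⟩

theorem measure_exists_lt_abs_pathSum_obsCoord_le (T : ℕ) {η : ℝ} (hη : 0 < η) :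
    histLaw D π T {h | ∃ j,
      2 * √(η * T) < |pathSum (compensated (roundKernel D π) (obsCoord j)) h|} ≤
      d * (2 * ENNReal.ofReal (Real.exp (-η))) := by
  rw [Set.ofPred_exists, histLaw_eq_seqLaw]
  simpa only [Fintype.card_fin] using measure_iUnion_le_card_mul fun j =>
    measure_lt_abs_pathSum_compensated_le (roundKernel D π) (measurable_obsCoord j)
      (obsCoord_mem_Icc j) T hη

theorem measure_lt_abs_pathSum_playedWidth_le (γ : ℝ) (T : ℕ) {η : ℝ} (hη : 0 < η) :
    histLaw D π T {h |
      2 * √(η * T) < |pathSum (compensated (roundKernel D π) (playedWidth γ)) h|} ≤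
      2 * ENNReal.ofReal (Real.exp (-η)) := by
  rw [histLaw_eq_seqLaw]
  exact measure_lt_abs_pathSum_compensated_le (roundKernel D π) (measurable_playedWidth γ)
    (playedWidth_mem_Icc γ) T hη

theorem measure_not_isConcentrated_le (γ : ℝ) (T : ℕ) {η : ℝ} (hη : 0 < η) :
    histLaw D π T {h | IsConcentrated D π γ η h}ᶜ ≤
      ENNReal.ofReal (2 * (T * (T * (d * m)) + d + 1) * Real.exp (-η)) := by
  have hsum := (measure_union_le _ _).trans (add_le_add ((measure_union_le _ _).trans (add_le_add
    (measure_exists_lt_abs_obsSum_sub_le D π T hη)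
    (measure_exists_lt_abs_pathSum_obsCoord_le D π T hη)))
    (measure_lt_abs_pathSum_playedWidth_le D π γ T hη))
  refine (measure_mono fun h hh => ?_).trans (hsum.trans_eq ?_)
  · by_contra hcon
    simp only [Set.mem_union, Set.mem_ofPred_eq, not_or, not_exists, not_lt] at hcon
    exact hh ⟨hcon.1.1, hcon.1.2, hcon.2⟩
  · rw [ENNReal.ofReal_mul (by positivity), ENNReal.ofReal_mul zero_le_two,
      ENNReal.ofReal_ofNat,
      show (T * (T * (d * m)) + d + 1 : ℝ) = (T * (T * (d * m)) + d + 1 : ℕ) by push_cast; rfl,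
      ENNReal.ofReal_natCast]
    push_cast
    ring

end Concentrated

/-! ### The regret -/

section Regret

variable {m d T : ℕ} {D : Fin m → Measure (Fin d → I)} {A : EstPolicy m d}
  {f : (Fin d → ℝ) → ℝ} {γ : ℝ} {x₀ : Fin d → ℝ} {h : Hist m d T}

theorem EstPolicy.avgEst_sub_mulVec_avgProb (hT : T ≠ 0) (M : Matrix (Fin d) (Fin m) ℝ)
    (h : Hist m d T) (j : Fin d) : A.avgEst x₀ h j - (M *ᵥ A.avgProb h) j =
      (∑ s : Fin T, (A.point (Fin.take s s.is_lt.le h) j -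
        (M *ᵥ A.prob s (Fin.take s s.is_lt.le h)) j)) / T := by
  simp only [avgEst, if_neg hT, Policy.avgProb, Matrix.mulVec_smul, Matrix.mulVec_sum,
    Pi.smul_apply, Finset.sum_apply, Finset.sum_sub_distrib, smul_eq_mul, point]
  ring

variable [∀ i, IsProbabilityMeasure (D i)]

theorem IsConcentrated.meanMatrix_mem_confSet (hγ : 1 ≤ γ)
    (hh : IsConcentrated D A.toPolicy γ (γ / 8) h) (s : ℕ) (hs : s < T) :
    meanMatrix D ∈ confSet γ (Fin.take s hs.le h) :=
  mem_confSet_of_abs_sub_le (meanMatrix_mem_Icc D) hγ _ (hh.abs_obsSum_sub_le s hs)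

theorem IsConcentrated.abs_avgEst_sub_mulVec_avgProb_le (hγ : 1 ≤ γ) (hT : T ≠ 0)
    (hA : A.IsPrimal f γ x₀ T) (hh : IsConcentrated D A.toPolicy γ (γ / 8) h) (j : Fin d) :
    |A.avgEst x₀ h j - (meanMatrix D *ᵥ A.avgProb h) j| ≤
      (16 * √(γ * m * T) + 2 * √(γ / 8 * T)) / T := by
  have hγ0 : 0 ≤ γ := zero_le_one.trans hγ
  rw [A.avgEst_sub_mulVec_avgProb hT, abs_div, Nat.abs_cast]
  gcongr
  calc |∑ s : Fin T, (A.point (Fin.take s s.is_lt.le h) j -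
        (meanMatrix D *ᵥ A.prob s (Fin.take s s.is_lt.le h)) j)|
      ≤ ∑ s : Fin T, |A.point (Fin.take s s.is_lt.le h) j -
        (meanMatrix D *ᵥ A.prob s (Fin.take s s.is_lt.le h)) j| := Finset.abs_sum_le_sum_abs _ _
    _ ≤ ∑ s : Fin T, ∑ i, A.prob s (Fin.take s s.is_lt.le h) i *
        width γ (Fin.take s s.is_lt.le h) i := Finset.sum_le_sum fun s _ =>
          abs_mulVec_sub_mulVec_le hγ0 (hA s s.is_lt _).1
            (hh.meanMatrix_mem_confSet hγ s s.is_lt) (A.prob_mem _ _).1 j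
    _ = pathSum (playedWidth γ) h -
        pathSum (compensated (roundKernel D A.toPolicy) (playedWidth γ)) h := by
          simp only [pathSum_compensated, integral_playedWidth, sub_sub_cancel]
    _ ≤ 16 * √(γ * m * T) + 2 * √(γ / 8 * T) := by
          linarith [pathSum_playedWidth_le hγ0 h, (abs_le.1 hh.abs_pathSum_playedWidth_le).1]

theorem IsConcentrated.abs_avgEst_sub_avgObs_le (hm : m ≠ 0) (hγ : 1 ≤ γ) (hT : T ≠ 0)
    (hA : A.IsPrimal f γ x₀ T) (hh : IsConcentrated D A.toPolicy γ (γ / 8) h) (j : Fin d) :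
    |(A.avgEst x₀ h - avgObs h) j| ≤ 20 * √(γ * m / T) := by
  have hT' : (0 : ℝ) < T := by positivity
  have hest := hh.abs_avgEst_sub_mulVec_avgProb_le hγ hT hA j
  have hobs : |(meanMatrix D *ᵥ A.avgProb h) j - avgObs h j| ≤ 2 * √(γ / 8 * T) / T := by
    rw [abs_sub_comm, avgObs_sub_mulVec_avgProb, abs_div, Nat.abs_cast]
    gcongr
    exact hh.abs_pathSum_obsCoord_le j
  have hroot : √(γ / 8 * T) ≤ √(γ * m * T) := by
    have hm' : (1 : ℝ) ≤ m := Nat.one_le_cast.2 (Nat.one_le_iff_ne_zero.2 hm)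
    gcongr
    nlinarith
  calc |(A.avgEst x₀ h - avgObs h) j|
      ≤ (16 * √(γ * m * T) + 2 * √(γ / 8 * T)) / T + 2 * √(γ / 8 * T) / T :=
        (abs_sub_le _ ((meanMatrix D *ᵥ A.avgProb h) j) _).trans (add_le_add hest hobs)
    _ ≤ (16 * √(γ * m * T) + 2 * √(γ * m * T)) / T + 2 * √(γ * m * T) / T := by gcongr
    _ = 20 * (√(γ * m * T) / T) := by ring
    _ = 20 * √(γ * m / T) := by
        rw [show γ * m / T = γ * m * T / T ^ 2 by field_simp, Real.sqrt_div' _ (sq_nonneg _),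
          Real.sqrt_sq hT'.le]

variable {q : ℝ≥0∞} {L C : ℝ}

theorem logb_two_mul_le {x : ℝ} (hx : 2 ≤ x) : Real.logb 2 (2 * x) ≤ 3 * Real.log x := by
  have hlog := Real.log_le_log two_pos hx
  rw [Real.logb, Real.log_mul two_ne_zero (by positivity), div_le_iff₀ (Real.log_pos one_lt_two)]
  nlinarith [Real.log_two_gt_d9]

theorem IsLipschitz.nonneg (hq : 1 ≤ q) (hd : d ≠ 0) (hL : IsLipschitz q L f) : 0 ≤ L := by
  have hle := hL 1 one_mem_cube 0 zero_mem_cube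
  have hge := hL 0 zero_mem_cube 1 one_mem_cube
  have hsymm : lqNorm q (0 - 1 : Fin d → ℝ) = lqNorm q (1 : Fin d → ℝ) := by
    have : Fact (1 ≤ q) := ⟨hq⟩
    rw [lqNorm, lqNorm, zero_sub, WithLp.toLp_neg, norm_neg]
  rw [sub_zero] at hle
  rw [hsymm] at hge
  exact nonneg_of_mul_nonneg_left (by linarith)
    (zero_lt_one.trans_le (one_le_lqNorm_one hd hq))

theorem IsLipschitz.sub_le (hq : 1 ≤ q) (hd : d ≠ 0) (hL : IsLipschitz q L f) {x y : Fin d → ℝ}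
    (hx : x ∈ cube d) (hy : y ∈ cube d) {c : ℝ} (hc : 0 ≤ c) (hxy : ∀ j, |(x - y) j| ≤ c) :
    f x - f y ≤ L * lqNorm q (1 : Fin d → ℝ) * c := by
  rw [mul_assoc, mul_comm _ c]
  exact (hL x hx y hy).trans
    (mul_le_mul_of_nonneg_left (lqNorm_le_mul_lqNorm_one hq hc hxy) (hL.nonneg hq hd))

theorem IsConcentrated.sub_avgObs_le (hm : m ≠ 0) (hd : d ≠ 0) (hT : T ≠ 0) (hγ : 1 ≤ γ)
    (hx₀ : x₀ ∈ cube d) (hA : A.IsPrimal f γ x₀ T) (hf : ConcaveOn ℝ (cube d) f)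
    (hs : IsSmooth C f) (hq : 1 ≤ q) (hL : IsLipschitz q L f)
    (hh : IsConcentrated D A.toPolicy γ (γ / 8) h) {p : Fin m → ℝ}
    (hp : p ∈ stdSimplex ℝ (Fin m)) :
    f (meanMatrix D *ᵥ p) - f (avgObs h) ≤
      20 * (L * lqNorm q (1 : Fin d → ℝ) * √(γ * m / T) + C * Real.log T / T) := by
  have hM := meanMatrix_mem_Icc D
  have hLN : 0 ≤ L * lqNorm q (1 : Fin d → ℝ) :=
    mul_nonneg (hL.nonneg hq hd) (lqNorm_nonneg hq _)
  obtain rfl | hT2 : T = 1 ∨ 2 ≤ T := by omega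
  · have hcube := mulVec_mem_cube hM hp
    have hdiam := hL.sub_le hq hd hcube (avgObs_mem_cube h) zero_le_one fun j =>
      abs_sub_le_of_nonneg_of_le (mem_cube.1 hcube j).1 (mem_cube.1 hcube j).2
        (mem_cube.1 (avgObs_mem_cube h) j).1 (mem_cube.1 (avgObs_mem_cube h) j).2
    have hroot : 1 ≤ √(γ * m) := Real.one_le_sqrt.2
      (one_le_mul_of_one_le_of_one_le hγ (Nat.one_le_cast.2 (Nat.one_le_iff_ne_zero.2 hm)))
    simp only [Nat.cast_one, Real.log_one, mul_zero, div_one, add_zero]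
    nlinarith [mul_le_mul_of_nonneg_left hroot hLN]
  · have hlip := hL.sub_le hq hd (hA.avgEst_mem_cube hx₀ le_rfl h) (avgObs_mem_cube h)
      (by positivity) (hh.abs_avgEst_sub_avgObs_le hm hγ hT hA)
    have hopt := hA.sub_le_logb hx₀ hf hs hM hp hT h (hh.meanMatrix_mem_confSet hγ)
    have hlogb : C * Real.logb 2 (2 * T) / (2 * T) ≤ 3 / 2 * (C * Real.log T / T) :=
      calc C * Real.logb 2 (2 * T) / (2 * T) ≤ C * (3 * Real.log T) / (2 * T) := by
            gcongr
            · exact hs.nonneg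
            · exact logb_two_mul_le (by exact_mod_cast hT2)
        _ = 3 / 2 * (C * Real.log T / T) := by ring
    have hlog : 0 ≤ C * Real.log T / T :=
      div_nonneg (mul_nonneg hs.nonneg (Real.log_natCast_nonneg T)) T.cast_nonneg
    linarith

theorem IsConcentrated.avgRegret_le (hm : m ≠ 0) (hd : d ≠ 0) (hT : T ≠ 0) (hγ : 1 ≤ γ)
    (hx₀ : x₀ ∈ cube d) (hA : A.IsPrimal f γ x₀ T) (hf : ConcaveOn ℝ (cube d) f)
    (hs : IsSmooth C f) (hq : 1 ≤ q) (hL : IsLipschitz q L f)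
    (hh : IsConcentrated D A.toPolicy γ (γ / 8) h) :
    avgRegret D f h ≤
      20 * (L * lqNorm q (1 : Fin d → ℝ) * √(γ * m / T) + C * Real.log T / T) := by
  have : Nonempty (Policy m d) := ⟨A.toPolicy⟩
  rw [avgRegret, sub_le_iff_le_add]
  exact opt_le D hf hs.1.continuousOn hT fun p hp =>
    sub_le_iff_le_add.1 (hh.sub_avgObs_le hm hd hT hγ hx₀ hA hf hs hq hL hp)

end Regret

/-! ### The failure probability -/

section Failure

theorem one_le_of_mul_log_le {x δ γ : ℝ} (hx : 2 ≤ x) (hδ : 0 < δ) (hδ1 : δ ≤ 1)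
    (hγ : 40 * Real.log (x / δ) ≤ γ) : 1 ≤ γ := by
  have hlog : Real.log 2 ≤ Real.log (x / δ) :=
    Real.log_le_log two_pos (hx.trans (le_div_self (by linarith) hδ hδ1))
  linarith [Real.log_two_gt_d9]

theorem mul_sq_mul_exp_le {x δ γ : ℝ} (hx : 2 ≤ x) (hδ : 0 < δ) (hδ1 : δ ≤ 1)
    (hγ : 40 * Real.log (x / δ) ≤ γ) : 6 * x ^ 2 * Real.exp (-(γ / 8)) ≤ δ := by
  have : 0 < x := by linarith
  have hexp : Real.exp (-(γ / 8)) ≤ (δ / x) ^ 5 :=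
    calc Real.exp (-(γ / 8)) ≤ Real.exp ((5 : ℕ) * Real.log (δ / x)) := by
          rw [Real.exp_le_exp, ← inv_div x δ, Real.log_inv]
          push_cast
          linarith
      _ = (δ / x) ^ 5 := by rw [Real.exp_nat_mul, Real.exp_log (by positivity)]
  have hratio : δ / x ≤ 1 / 2 := div_le_div₀ zero_le_one hδ1 two_pos hx
  calc 6 * x ^ 2 * Real.exp (-(γ / 8)) ≤ 6 * x ^ 2 * (δ / x) ^ 5 := by gcongr
    _ = 6 * δ * δ * (δ / x) ^ 3 := by field_simp
    _ ≤ 6 * δ * 1 * (1 / 2) ^ 3 := by gcongr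
    _ ≤ δ := by linarith

theorem mul_add_add_one_le_three_mul_sq {m d T : ℕ} (h : m * T * d ≠ 0) :
    T * (T * (d * m)) + d + 1 ≤ 3 * (m * T * d) ^ 2 := by
  have hN : 0 < m * T * d := Nat.pos_of_ne_zero h
  have hT : T ≤ m * T * d := Nat.le_of_dvd hN ⟨m * d, by ring⟩
  have hd : d ≤ m * T * d := Nat.le_of_dvd hN ⟨m * T, by ring⟩
  nlinarith [Nat.mul_le_mul_right (m * T * d) hT]

theorem ofReal_one_sub_le_of_compl {Ω : Type*} [MeasurableSpace Ω] {μ : Measure Ω}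
    [IsProbabilityMeasure μ] {s : Set Ω} {δ : ℝ} (hδ : 0 ≤ δ) (hs : μ sᶜ ≤ ENNReal.ofReal δ) :
    ENNReal.ofReal (1 - δ) ≤ μ s := by
  rw [ENNReal.ofReal_sub _ hδ, ENNReal.ofReal_one, tsub_le_iff_right, ← measure_univ (μ := μ)]
  exact (measure_univ_le_add_compl s).trans (add_le_add_right hs _)

variable {m d T : ℕ} (D : Fin m → Measure (Fin d → I)) [∀ i, IsProbabilityMeasure (D i)]

theorem le_measure_isConcentrated (π : Policy m d) (hmTd : 2 ≤ m * T * d) {δ γ : ℝ} (hδ : 0 < δ)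
    (hδ1 : δ ≤ 1) (hγ : 40 * Real.log (m * T * d / δ) ≤ γ) :
    ENNReal.ofReal (1 - δ) ≤ histLaw D π T {h | IsConcentrated D π γ (γ / 8) h} := by
  have hx : (2 : ℝ) ≤ m * T * d := by exact_mod_cast hmTd
  have hγ1 := one_le_of_mul_log_le hx hδ hδ1 hγ
  have hcount : (T * (T * (d * m)) + d + 1 : ℝ) ≤ 3 * (m * T * d) ^ 2 := by
    exact_mod_cast mul_add_add_one_le_three_mul_sq (by omega : m * T * d ≠ 0)
  refine ofReal_one_sub_le_of_compl hδ.le ((measure_not_isConcentrated_le D π γ T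
    (by positivity)).trans (ENNReal.ofReal_le_ofReal ?_))
  calc 2 * (T * (T * (d * m)) + d + 1 : ℝ) * Real.exp (-(γ / 8))
      ≤ 2 * (3 * (m * T * d) ^ 2) * Real.exp (-(γ / 8)) := by gcongr
    _ ≤ δ := by linarith [mul_sq_mul_exp_le hx hδ hδ1 hγ]

end Failure

end BwR

end

theorem theorem4_general {m d T : ℕ} (hmTd : 2 ≤ m * T * d)
    (D : Fin m → Measure (Fin d → unitInterval)) [∀ i, IsProbabilityMeasure (D i)]
    {q : ENNReal} (hq : 1 ≤ q) {f : (Fin d → ℝ) → ℝ} {L C : ℝ}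
    (hf : ConcaveOn ℝ (BwR.cube d) f) (hL : BwR.IsLipschitz q L f) (hs : BwR.IsSmooth C f)
    {δ : ℝ} (hδ : 0 < δ) (hδ1 : δ ≤ 1) {γ : ℝ} (hγ : 40 * Real.log (m * T * d / δ) ≤ γ)
    {x₀ : Fin d → ℝ} (hx₀ : x₀ ∈ BwR.cube d) {A : BwR.EstPolicy m d} (hA : A.IsPrimal f γ x₀ T) :
    ENNReal.ofReal (1 - δ) ≤ BwR.histLaw D A.toPolicy T
      {h | BwR.avgRegret D f h ≤
              20 * (L * BwR.lqNorm q (1 : Fin d → ℝ) * √(γ * m / T) + C * Real.log T / T) ∧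
           ∀ p ∈ stdSimplex ℝ (Fin m),
              f (BwR.meanMatrix D *ᵥ p) - f (A.avgEst x₀ h) ≤
                C * Real.logb 2 (2 * T) / (2 * T)} := by
  obtain ⟨⟨hm, hT⟩, hd⟩ : (m ≠ 0 ∧ T ≠ 0) ∧ d ≠ 0 := by
    simpa only [ne_eq, mul_eq_zero, not_or] using (by omega : m * T * d ≠ 0)
  have hγ1 : 1 ≤ γ := BwR.one_le_of_mul_log_le (by exact_mod_cast hmTd) hδ hδ1 hγ
  refine (BwR.le_measure_isConcentrated D A.toPolicy hmTd hδ hδ1 hγ).trans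
    (measure_mono fun h hh => ⟨?_, fun p hp => ?_⟩)
  · exact hh.avgRegret_le hm hd hT hγ1 hx₀ hA hf hs hq hL
  · exact hA.sub_le_logb hx₀ hf hs (BwR.meanMatrix_mem_Icc D) hp hT h
      (hh.meanMatrix_mem_confSet hγ1)

theorem theorem4 :
    ∃ c₀ : ℝ, 0 < c₀ ∧ ∃ K : ℝ, 0 < K ∧
      ∀ (m d T : ℕ), 2 ≤ m * T * d →
      ∀ (D : Fin m → Measure (Fin d → unitInterval)), (∀ i, IsProbabilityMeasure (D i)) →
      ∀ (q : ENNReal), 1 ≤ q →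
      ∀ (f : (Fin d → ℝ) → ℝ) (L C : ℝ),
        (∀ x ∈ BwR.cube d, f x ∈ Set.Icc (0 : ℝ) 1) →
        ConcaveOn ℝ (BwR.cube d) f →
        BwR.IsLipschitz q L f →
        BwR.IsSmooth C f →
      ∀ (δ : ℝ), 0 < δ → δ < 1 →
      ∀ (γ : ℝ), c₀ * Real.log (m * T * d / δ) ≤ γ →
      ∀ (x₀ : Fin d → ℝ), x₀ ∈ BwR.cube d →
      ∀ (A : BwR.EstPolicy m d), A.IsPrimal f γ x₀ T →
        ENNReal.ofReal (1 - δ) ≤ BwR.histLaw D A.toPolicy T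
          {h | BwR.avgRegret D f h ≤
                  K * (L * BwR.lqNorm q (1 : Fin d → ℝ) * √(γ * m / T)
                    + C * Real.log T / T) ∧
               ∀ p ∈ stdSimplex ℝ (Fin m),
                  f (BwR.meanMatrix D *ᵥ p) - f (A.avgEst x₀ h) ≤
                    C * Real.logb 2 (2 * T) / (2 * T)} := by
  exact ⟨40, by norm_num, 20, by norm_num, fun _ _ _ hmTd D _ _ hq _ _ _ _ hf hL hs _ hδ hδ1 _ hγ
    _ hx₀ _ hA => theorem4_general hmTd D hq hf hL hs hδ hδ1.le hγ hx₀ hA⟩
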